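/- Let $K$ be a field of characteristic zero (for instance $\mathbb{Q}$ or $\mathbb{C}$) and let $\omega$ be the exponent of square matrix multiplication over $K$, i.e. the minimal real number $\tau$ such that for every $\varepsilon>0$ the product of two $n\times n$ matrices over $K$ can be computed by an algebraic (bilinear) algorithm of rank $O(n^{\tau+\varepsilon})$. Consider the congested clique with $n$ nodes: in each synchronous round every node can send to each node a (possibly different) message of $\lceil\log_2 n\rceil$ bits, and local computation is free. Let $M$ be an integer with $1\le M\le n$. The input is an undirected graph on $n$ vertices whose edges have integer weights in $\{0,\ldots,M\}$, where node $\ell$ initially knows the $\ell$-th row (equivalently, the $\ell$-th column) of the adjacency matrix, whose entries are the edge weights, with $\infty$ for non-adjacent pairs. The diameter is the maximum, over all pairs of vertices, of the smallest total weight of a walk joining them; it is $\infty$ if the graph is disconnected. Then the deterministic round complexity of computing the diameter (every node outputs it) is $\tilde O(M^{2/\omega}n^{1-2/\omega})$, where, as usual, the $o(1)$ in the exponent $\omega$ is ignored. Precisely: there is a constant $c$ such that for every $\varepsilon>0$ there is a constant $C$ such that, for all integers $1\le M\le n$, there is a deterministic congested clique algorithm that computes the diameter of every such graph in at most $$C\,M^{2/(\omega+\varepsilon)}\,n^{1-2/(\omega+\varepsilon)}\,(\log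 n)^{c}$$ rounds. -/

import Mathlib

namespace CongestedClique

/-! ### Algebraic algorithms and the exponent of matrix multiplication -/

/-- An algebraic (bilinear) algorithm of rank `t` over the field `K` for the product of an
`n × m` matrix by an `m × n` matrix: coefficient families `α`, `β`, `lam` such that
`(A * B) i j = ∑ μ, lam i j μ * S μ * T μ`, where `S μ` is the linear form in the entries of `A`
with coefficients `α · · μ` and `T μ` is the linear form in the entries of `B` with coefficients
`β · · μ`. -/
structure AlgebraicAlgorithm (K : Type*) [Field K] (n m t : ℕ) where
  α : Fin n → Fin m → Fin t → K
  β : Fin n → Fin m → Fin t → K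
  lam : Fin n → Fin n → Fin t → K
  correct : ∀ (A : Matrix (Fin n) (Fin m) K) (B : Matrix (Fin m) (Fin n) K) (i j : Fin n),
    (A * B) i j =
      ∑ μ : Fin t, lam i j μ *
        (∑ i' : Fin n, ∑ j' : Fin m, α i' j' μ * A i' j') *
        (∑ i' : Fin n, ∑ j' : Fin m, β i' j' μ * B j' i')

/-- The real numbers `τ` such that, for every `ε > 0`, the product of two `n × n` matrices over `K`
can be computed by an algebraic algorithm of rank `O(n ^ (τ + ε))`. -/
def admissibleExponents (K : Type*) [Field K] : Set ℝ :=
  {τ | ∀ ε : ℝ, 0 < ε → ∃ C : ℝ, ∀ n : ℕ, 1 ≤ n →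
    ∃ t : ℕ, (t : ℝ) ≤ C * (n : ℝ) ^ (τ + ε) ∧ Nonempty (AlgebraicAlgorithm K n n t)}

/-- The exponent `ω` of square matrix multiplication over `K`. The infimum is a minimum of a
nonempty set of reals that is bounded below. -/
noncomputable def matMulExponent (K : Type*) [Field K] : ℝ :=
  sInf (admissibleExponents K)

/-! ### Weighted graphs and the diameter -/

/-- An undirected graph on the vertex set `Fin n` with integer edge weights in `{0, …, M}`. The
values of `weight` at non-adjacent pairs are irrelevant. -/
structure WeightedGraph (n M : ℕ) where
  graph : SimpleGraph (Fin n)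
  weight : Fin n → Fin n → ℕ
  weight_symm : ∀ u v, graph.Adj u v → weight u v = weight v u
  weight_le : ∀ u v, graph.Adj u v → weight u v ≤ M

namespace WeightedGraph

variable {n M : ℕ} (G : WeightedGraph n M)

/-- The total weight of a walk. -/
def walkLength {u v : Fin n} (p : G.graph.Walk u v) : ℕ :=
  (p.darts.map fun d => G.weight d.fst d.snd).sum

/-- The weighted distance; it is `⊤` if there is no walk from `u` to `v`. -/
noncomputable def dist (u v : Fin n) : ℕ∞ :=
  ⨅ p : G.graph.Walk u v, (G.walkLength p : ℕ∞)

/-- The diameter, i.e. the largest distance; it is `⊤` if the graph is disconnected. -/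
noncomputable def diameter : ℕ∞ :=
  ⨆ (u : Fin n) (v : Fin n), G.dist u v

open Classical in
/-- The adjacency matrix: the weight of the edge `uv` if there is one, and `⊤` otherwise. -/
noncomputable def adjMatrix (u v : Fin n) : ℕ∞ :=
  if G.graph.Adj u v then (G.weight u v : ℕ∞) else ⊤

end WeightedGraph

/-! ### The congested clique -/

/-- Messages of `b` bits. -/
abbrev Message (b : ℕ) : Type := Fin b → Bool

/-- A deterministic algorithm for the congested clique with `n` nodes and `b`-bit messages, where
each node receives an input in `I` and produces an output in `O`. Computation proceeds in
synchronous rounds and local computation is unrestricted. What a node sends in a round, possibly a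
different message to each node, is a function of its identifier, its own input and the messages
that it received in the earlier rounds (the entry of the list at position `s` holds the messages
received in round `s`, indexed by the sender). Its output is a function of the same data after
the last round. -/
structure Protocol (n b : ℕ) (I O : Type) where
  rounds : ℕ
  send : Fin n → I → List (Fin n → Message b) → Fin n → Message b
  output : Fin n → I → List (Fin n → Message b) → O

namespace Protocol

variable {n b : ℕ} {I O : Type} (P : Protocol n b I O)

/-- The messages received by node `i` during the first `t` rounds when node `j` has input `x j`. -/
def received (x : Fin n → I) : ℕ → Fin n → List (Fin n → Message b)
  | 0, _ => []
  | t + 1, i => received x t i ++ [fun j => P.send j (x j) (received x t j) i]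

/-- The output of node `i` when node `j` has input `x j`. -/
def result (x : Fin n → I) (i : Fin n) : O :=
  P.output i (x i) (P.received x P.rounds i)

end Protocol

/-- The protocol computes the diameter of undirected graphs with `n` vertices and weights in
`{0, …, M}`: on every such graph, if each node `i` is initially given row `i` of the adjacency
matrix (which is also its column `i`, since the matrix is symmetric), then at the end every node
outputs the diameter. -/
def ComputesDiameter {n b : ℕ} (M : ℕ) (P : Protocol n b (Fin n → ℕ∞) ℕ∞) : Prop :=
  ∀ (G : WeightedGraph n M) (i : Fin n), P.result (fun j => G.adjMatrix j) i = G.diameter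

end CongestedClique

/-!
The min-plus product of matrices with entries in `{0, …, W, ∞}` is read off from an ordinary product
of polynomial matrices: replace an entry `a` by `X ^ a` and `∞` by `0`, and look at the trailing
degree of each entry of the product. Over a prime field with more than `n` elements no cancellation
can occur, and evaluation at `2 * W + 1` points and interpolation turn the polynomial product into
`2 * W + 1` products over the field. These are computed simultaneously: the matrices are cut into
`d × d` blocks, the products of linear forms of a bilinear scheme for `d × d` matrices at each of
the points become independent products of smaller matrices, and these are distributed evenly over
the nodes. The scheme over the prime field comes from one over `K` by specialization to a finite
extension of `ℚ`, restriction of scalars to `ℚ`, and reduction modulo all but finitely many primes;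
its tensor powers serve for larger `d`.

All distances are bounded by `(n - 1) * M` but only those in a window of width `O(M)` around a given
value matter. A walk of weight at least `S + T` can be cut near `S`, up to an error of `M`, so the
window around `S + T` is the min-plus product of the windows around `S` and `T`. Hence products with
entries of size `O(M)` suffice to double the centre of the window, and then to find the diameter by
binary search, with `O(log n)` products in total.
-/

namespace CongestedClique

namespace Protocol

variable {n b : ℕ} {I J O S S' : Type}

theorem length_received (P : Protocol n b I O) (x : Fin n → I) (t : ℕ) (i : Fin n) :
    (P.received x t i).length = t := by
  induction t with
  | zero => rfl
  | succ t ih => simp [received, ih]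

theorem getElem?_received (P : Protocol n b I O) (x : Fin n → I) {s t : ℕ} (h : s < t)
    (i : Fin n) :
    (P.received x t i)[s]? = some fun j => P.send j (x j) (P.received x s j) i := by
  induction t with
  | zero => exact absurd h (Nat.not_lt_zero s)
  | succ t ih =>
    rw [received]
    rcases Nat.lt_succ_iff_lt_or_eq.1 h with hst | rfl
    · rw [List.getElem?_append_left (by rwa [length_received]), ih hst]
    · rw [List.getElem?_append_right (by rw [length_received])]
      simp [length_received]

/-- The protocol `P` run on preprocessed inputs, with its outputs postprocessed. Both conversions
are local, and the postprocessing may use the original input. -/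
def dimap (P : Protocol n b I O) (pre : S → I) (post : S → O → S') : Protocol n b S S' where
  rounds := P.rounds
  send i s l := P.send i (pre s) l
  output i s l := post s (P.output i (pre s) l)

theorem result_dimap (P : Protocol n b I O) (pre : S → I) (post : S → O → S') (x : Fin n → S)
    (i : Fin n) :
    (P.dimap pre post).result x i = post (x i) (P.result (fun j => pre (x j)) i) := by
  have received_eq (t : ℕ) (i : Fin n) :
      (P.dimap pre post).received x t i = P.received (fun j => pre (x j)) t i := by
    induction t generalizing i with
    | zero => rfl
    | succ t ih => simp only [received, ih]; rfl
  simp only [result, received_eq]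
  rfl

/-- The protocol that runs `P`, and then runs `Q` on the outputs of `P`. -/
def comp (Q : Protocol n b J O) (P : Protocol n b I J) : Protocol n b I O where
  rounds := P.rounds + Q.rounds
  send i s l :=
    if l.length < P.rounds then P.send i s l
    else Q.send i (P.output i s (l.take P.rounds)) (l.drop P.rounds)
  output i s l := Q.output i (P.output i s (l.take P.rounds)) (l.drop P.rounds)

theorem received_comp_of_le (Q : Protocol n b J O) (P : Protocol n b I J) (x : Fin n → I) {t : ℕ}
    (ht : t ≤ P.rounds) (i : Fin n) : (Q.comp P).received x t i = P.received x t i := by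
  induction t generalizing i with
  | zero => rfl
  | succ t ih =>
    have ht' : t < P.rounds := ht
    simp only [received, ih ht'.le]
    simp [comp, length_received, ht']

theorem received_comp_add (Q : Protocol n b J O) (P : Protocol n b I J) (x : Fin n → I) (t : ℕ)
    (i : Fin n) :
    (Q.comp P).received x (P.rounds + t) i =
      P.received x P.rounds i ++ Q.received (P.result x) t i := by
  induction t generalizing i with
  | zero => simp [received_comp_of_le, received]
  | succ t ih =>
    rw [← add_assoc]
    simp only [received, ih, List.append_assoc]
    simp [comp, length_received, result]

theorem result_comp (Q : Protocol n b J O) (P : Protocol n b I J) (x : Fin n → I) (i : Fin n) :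
    (Q.comp P).result x i = Q.result (P.result x) i := by
  have h := received_comp_add Q P x Q.rounds i
  simp only [result, comp] at h ⊢
  simp [h, length_received]

/-- The protocol in which every node `j` transmits the value `msg j s i`, determined by its input
`s`, to each node `i`, one message of the code word `enc (msg j s i)` per round. -/
noncomputable def exchange {V : Type} [Nonempty V] {w : ℕ} (enc : V ↪ (Fin w → Message b))
    (msg : Fin n → I → Fin n → V) : Protocol n b I (Fin n → V) where
  rounds := w
  send j s l i := if h : l.length < w then enc (msg j s i) ⟨l.length, h⟩ else fun _ => false
  output _ _ l j := Function.invFun enc fun s : Fin w => (l[(s : ℕ)]?).getD (fun _ _ => false) j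

theorem result_exchange {V : Type} [Nonempty V] {w : ℕ} (enc : V ↪ (Fin w → Message b))
    (msg : Fin n → I → Fin n → V) (x : Fin n → I) (i : Fin n) :
    (exchange enc msg).result x i = fun j => msg j (x j) i := by
  funext j
  have code_word :
      (fun s : Fin w => (((exchange enc msg).received x w i)[(s : ℕ)]?).getD
        (fun _ _ => false) j) = enc (msg j (x j) i) := by
    funext s
    rw [getElem?_received _ _ s.isLt]
    simp [exchange, length_received]
  exact (congrArg _ code_word).trans (Function.leftInverse_invFun enc.injective _)

end Protocol

/-- Some protocol with `R` rounds of `b`-bit messages computes `f`, where `f x i` is the output of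
node `i` when node `j` has input `x j`. -/
def Computes (n b R : ℕ) {I O : Type} (f : (Fin n → I) → Fin n → O) : Prop :=
  ∃ P : Protocol n b I O, P.rounds = R ∧ ∀ x i, P.result x i = f x i

namespace Computes

variable {n b R : ℕ} {I J O S S' : Type}

theorem congr {f g : (Fin n → I) → Fin n → O} (h : Computes n b R f) (hfg : ∀ x i, f x i = g x i) :
    Computes n b R g :=
  h.imp fun _ hP => ⟨hP.1, fun x i => (hP.2 x i).trans (hfg x i)⟩

theorem of_local (g : Fin n → I → O) : Computes n b 0 fun (x : Fin n → I) i => g i (x i) :=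
  ⟨⟨0, fun _ _ _ _ _ => false, fun i s _ => g i s⟩, rfl, fun _ _ => rfl⟩

theorem dimap {f : (Fin n → I) → Fin n → O} (h : Computes n b R f) (pre : S → I)
    (post : S → O → S') :
    Computes n b R fun (x : Fin n → S) i => post (x i) (f (fun j => pre (x j)) i) := by
  obtain ⟨P, hR, hP⟩ := h
  exact ⟨P.dimap pre post, hR, fun x i => by rw [P.result_dimap, hP]⟩

theorem comp {R₁ R₂ : ℕ} {f : (Fin n → I) → Fin n → J} {g : (Fin n → J) → Fin n → O}
    (hg : Computes n b R₂ g) (hf : Computes n b R₁ f) :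
    Computes n b (R₁ + R₂) fun x => g (f x) := by
  obtain ⟨P, rfl, hP⟩ := hf
  obtain ⟨Q, rfl, hQ⟩ := hg
  refine ⟨Q.comp P, rfl, fun x i => ?_⟩
  rw [Protocol.result_comp, hQ, funext (hP x)]

theorem iterate {f : (Fin n → I) → Fin n → I} (h : Computes n b R f) (m : ℕ) :
    Computes n b (m * R) f^[m] := by
  induction m with
  | zero => rw [Nat.zero_mul]; exact of_local fun _ s => s
  | succ m ih => rw [Nat.succ_mul, Nat.add_comm, Function.iterate_succ]; exact ih.comp h

theorem exchange {V : Type} [Fintype V] [Nonempty V] {w : ℕ} (hV : Fintype.card V ≤ 2 ^ (b * w))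
    (msg : Fin n → I → Fin n → V) :
    Computes n b w fun (x : Fin n → I) i j => msg j (x j) i := by
  have hcard : Fintype.card V ≤ Fintype.card (Fin w → Message b) := by
    simpa [Message, pow_mul] using hV
  obtain ⟨enc⟩ := Function.Embedding.nonempty_of_card_le hcard
  exact ⟨Protocol.exchange enc msg, rfl, Protocol.result_exchange enc msg⟩

end Computes

theorem exists_coloring_of_degree_lt_card {V C : Type*} [Fintype V] [Fintype C]
    (G : SimpleGraph V) [DecidableRel G.Adj] (h : ∀ v, G.degree v < Fintype.card C) :
    Nonempty (G.Coloring C) := by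
  classical
  rcases isEmpty_or_nonempty V with hV | ⟨⟨v₀⟩⟩
  · exact ⟨⟨isEmptyElim, fun {v} => isEmptyElim v⟩⟩
  have : Nonempty C := Fintype.card_pos_iff.1 (Nat.zero_lt_of_lt (h v₀))
  suffices greedy : ∀ A : Finset V, ∃ c : V → C, ∀ u ∈ A, ∀ v ∈ A, G.Adj u v → c u ≠ c v by
    obtain ⟨c, hc⟩ := greedy Finset.univ
    exact ⟨⟨c, fun {u v} => hc u (Finset.mem_univ u) v (Finset.mem_univ v)⟩⟩
  intro A
  induction A using Finset.induction_on with
  | empty => exact ⟨fun _ => Classical.arbitrary C, by simp⟩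
  | insert a A ha ih =>
    obtain ⟨c, hc⟩ := ih
    obtain ⟨k, hk⟩ : ∃ k, k ∉ (G.neighborFinset a).image c := by
      by_contra! hall
      have : Fintype.card C ≤ G.degree a :=
        (Finset.card_le_card fun k _ => hall k).trans Finset.card_image_le
      exact absurd this (not_le.2 (h a))
    have hk' (v : V) (hav : G.Adj a v) : c v ≠ k := fun hv =>
      hk (Finset.mem_image.2 ⟨v, (G.mem_neighborFinset a v).2 hav, hv⟩)
    have ne_a {v : V} (hv : v ∈ A) : v ≠ a := fun h => ha (h ▸ hv)
    refine ⟨Function.update c a k, fun u hu v hv huv => ?_⟩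
    rcases Finset.mem_insert.1 hu with rfl | huA <;>
      rcases Finset.mem_insert.1 hv with rfl | hvA
    · exact absurd huv G.irrefl
    · simpa [ne_a hvA] using (hk' v huv).symm
    · simpa [ne_a huA] using hk' u huv.symm
    · simpa [ne_a huA, ne_a hvA] using hc u huA v hvA huv

/-- Each value is taken by `f` at most `L` times. When `f` places items on nodes, this bounds the
number of items per node. -/
def LoadLE {E X : Type*} [Fintype E] [DecidableEq X] (f : E → X) (L : ℕ) : Prop :=
  ∀ v, (Finset.univ.filter fun e => f e = v).card ≤ L

namespace LoadLE

variable {E X Y Z : Type*} [Fintype E] [Fintype Y] [Fintype Z] [DecidableEq X]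

theorem mono {f : E → X} {L L' : ℕ} (h : LoadLE f L) (hL : L ≤ L') : LoadLE f L' :=
  fun v => (h v).trans hL

theorem of_injective_fst {g : Y → X} {h : ℕ} (hg : LoadLE g h) {φ : E → Y × Z}
    (hφ : Function.Injective φ) : LoadLE (fun e => g (φ e).1) (h * Fintype.card Z) := by
  intro v
  calc (Finset.univ.filter fun e => g (φ e).1 = v).card
      ≤ ((Finset.univ.filter fun y => g y = v) ×ˢ (Finset.univ : Finset Z)).card :=
        Finset.card_le_card_of_injOn φ (fun e he => by simpa using he) hφ.injOn
    _ ≤ h * Fintype.card Z := by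
        rw [Finset.card_product]
        exact Nat.mul_le_mul_right _ (hg v)

theorem exists_fin (Y : Type*) [Fintype Y] {n : ℕ} (hn : 0 < n) :
    ∃ f : Y → Fin n, LoadLE f (Fintype.card Y / n + 1) := by
  let e := Fintype.equivFin Y
  refine ⟨fun y => ⟨e y % n, Nat.mod_lt _ hn⟩, fun v => ?_⟩
  rw [← Finset.card_range (Fintype.card Y / n + 1)]
  refine Finset.card_le_card_of_injOn (fun y => (e y : ℕ) / n) (fun y _ => ?_) ?_
  · exact Finset.mem_coe.2 (Finset.mem_range_succ_iff.2 (Nat.div_le_div_right (e y).isLt.le))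
  · intro y hy z hz (hdiv : (e y : ℕ) / n = e z / n)
    have hmod : (e y : ℕ) % n = e z % n := by
      have hyz := (Finset.mem_filter.1 hy).2.trans (Finset.mem_filter.1 hz).2.symm
      exact congrArg Fin.val hyz
    apply e.injective
    rw [Fin.ext_iff, ← Nat.div_add_mod (e y : ℕ) n, ← Nat.div_add_mod (e z : ℕ) n, hmod, hdiv]

theorem exists_edge_coloring {C : Type*} [Fintype C] {src dst : E → X} {L : ℕ}
    (hs : LoadLE src L) (hd : LoadLE dst L) (hC : 2 * L ≤ Fintype.card C) :
    ∃ c : E → C, ∀ e e', src e = src e' ∨ dst e = dst e' → c e = c e' → e = e' := by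
  classical
  let G : SimpleGraph E := SimpleGraph.fromRel fun e e' => src e = src e' ∨ dst e = dst e'
  have adj_iff (e e' : E) : G.Adj e e' ↔ e ≠ e' ∧ (src e = src e' ∨ dst e = dst e') := by
    rw [SimpleGraph.fromRel_adj, eq_comm (a := src e'), eq_comm (a := dst e'), or_self]
  have degree_lt (e : E) : G.degree e < Fintype.card C := by
    let S := Finset.univ.filter fun e' => src e' = src e
    let D := Finset.univ.filter fun e' => dst e' = dst e
    have hS : (S.erase e).card < S.card := Finset.card_erase_lt_of_mem (by simp [S])
    have hD : (D.erase e).card < D.card := Finset.card_erase_lt_of_mem (by simp [D])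
    have hSL : S.card ≤ L := hs (src e)
    have hDL : D.card ≤ L := hd (dst e)
    have hsub : G.neighborFinset e ⊆ S.erase e ∪ D.erase e := fun e' he' => by
      have := (adj_iff e e').1 ((G.mem_neighborFinset e e').1 he')
      simpa [S, D, ← and_or_left, eq_comm] using this
    have hdeg : G.degree e ≤ (S.erase e).card + (D.erase e).card :=
      (Finset.card_le_card hsub).trans (Finset.card_union_le _ _)
    omega
  obtain ⟨c⟩ := exists_coloring_of_degree_lt_card G degree_lt
  refine ⟨c, fun e e' h hc => ?_⟩
  by_contra hne
  exact c.valid ((adj_iff e e').2 ⟨hne, h⟩) hc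

end LoadLE

theorem Computes.route {n b w r L : ℕ} {I E V : Type} [Fintype E] [Fintype V] [Inhabited V]
    (hV : Fintype.card V ≤ 2 ^ (b * w)) {src dst : E → Fin n} (hs : LoadLE src L)
    (hd : LoadLE dst L) (hL : 2 * L ≤ n * r) (val : E → I → V) :
    Computes n b (2 * (w * r)) fun (x : Fin n → I) i e =>
      if dst e = i then val e (x (src e)) else default := by
  classical
  -- An item of colour `(k, q)` travels through the intermediate node `k`, as entry `q` of the
  -- message from its source to `k` and of the message from `k` to its target.
  obtain ⟨c, hc⟩ := hs.exists_edge_coloring hd (C := Fin n × Fin r) (by simpa using hL)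
  have hV' : Fintype.card (Fin r → V) ≤ 2 ^ (b * (w * r)) := by
    rw [Fintype.card_fun, Fintype.card_fin, ← mul_assoc, pow_mul]
    exact Nat.pow_le_pow_left hV r
  have scatter := Computes.exchange (n := n) (I := I) hV' fun j s k q =>
    if h : ∃ e, src e = j ∧ c e = (k, q) then val h.choose s else default
  have gather := Computes.exchange (n := n) (I := Fin n → Fin r → V) hV' fun k s i q =>
    if h : ∃ e, dst e = i ∧ c e = (k, q) then s (src h.choose) q else default
  rw [two_mul]
  refine ((Computes.of_local fun i (s : Fin n → Fin r → V) e =>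
    if dst e = i then s (c e).1 (c e).2 else default).comp (gather.comp scatter)).congr
      fun x i => funext fun e => ?_
  by_cases hi : dst e = i
  · have hdst : ∃ e', dst e' = i ∧ c e' = ((c e).1, (c e).2) := ⟨e, hi, rfl⟩
    have hsrc : ∃ e', src e' = src e ∧ c e' = ((c e).1, (c e).2) := ⟨e, rfl, rfl⟩
    have dst_choose : hdst.choose = e :=
      hc _ _ (Or.inr (hdst.choose_spec.1.trans hi.symm)) hdst.choose_spec.2
    have src_choose : hsrc.choose = e := hc _ _ (Or.inl hsrc.choose_spec.1) hsrc.choose_spec.2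
    simp only [if_pos hi]
    rw [dif_pos hdst, dst_choose, dif_pos hsrc, src_choose]
  · simp only [if_neg hi]

/-- A bilinear scheme for the product of square matrices indexed by `ι`, with one product of linear
forms for each element of `τ`: the matrices `A` and `B` are multiplied through the linear forms with
coefficients `α · · μ` in the entries of `A` and `β · · μ` in the entries of the transpose of `B`.
Its correctness is expressed by the Brent equations, which makes sense for infinite `ι`. -/
structure Scheme (R ι τ : Type*) [CommRing R] [DecidableEq ι] [Fintype τ] where
  α : ι → ι → τ → R
  β : ι → ι → τ → R
  lam : ι → ι → τ → R
  brent : ∀ i j i' j' k l, ∑ μ, lam i j μ * α i' j' μ * β k l μ =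
    if i = i' ∧ j' = l ∧ j = k then 1 else 0

namespace Scheme

variable {R S ι κ τ υ : Type*} [CommRing R] [CommRing S] [DecidableEq ι] [DecidableEq κ]
  [Fintype τ] [Fintype υ]

theorem mul_apply [Fintype ι] (s : Scheme R ι τ) (A B : Matrix ι ι R) (i j : ι) :
    (A * B) i j = ∑ μ, s.lam i j μ *
      ((∑ i', ∑ j', s.α i' j' μ * A i' j') * ∑ k, ∑ l, s.β k l μ * B l k) := by
  have expand (μ : τ) : s.lam i j μ *
      ((∑ i', ∑ j', s.α i' j' μ * A i' j') * ∑ k, ∑ l, s.β k l μ * B l k) =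
      ∑ p : ι × ι, ∑ q : ι × ι,
        s.lam i j μ * s.α p.1 p.2 μ * s.β q.1 q.2 μ * (A p.1 p.2 * B q.2 q.1) := by
    rw [← Fintype.sum_prod_type' fun i' j' => s.α i' j' μ * A i' j',
      ← Fintype.sum_prod_type' fun k l => s.β k l μ * B l k, Fintype.sum_mul_sum]
    simp only [Finset.mul_sum]
    exact Fintype.sum_congr _ _ fun p => Fintype.sum_congr _ _ fun q => by ring
  simp only [expand]
  rw [Finset.sum_comm]
  simp only [Finset.sum_comm (s := (Finset.univ : Finset τ)), ← Finset.sum_mul, s.brent]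
  simp [Fintype.sum_prod_type, Matrix.mul_apply, ite_and]

/-- The extension of scalars of a scheme along a ring homomorphism. -/
def map (s : Scheme R ι τ) (f : R →+* S) : Scheme S ι τ where
  α i j μ := f (s.α i j μ)
  β i j μ := f (s.β i j μ)
  lam i j μ := f (s.lam i j μ)
  brent i j i' j' k l := by
    simpa [apply_ite f] using congrArg f (s.brent i j i' j' k l)

/-- The restriction of a scheme to submatrices, with the products relabelled. -/
def comap (s : Scheme R ι τ) (e : κ ↪ ι) (g : υ ≃ τ) : Scheme R κ υ where
  α i j μ := s.α (e i) (e j) (g μ)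
  β i j μ := s.β (e i) (e j) (g μ)
  lam i j μ := s.lam (e i) (e j) (g μ)
  brent i j i' j' k l := by
    rw [Equiv.sum_comp g fun μ => s.lam (e i) (e j) μ * s.α (e i') (e j') μ * s.β (e k) (e l) μ]
    simp only [s.brent, EmbeddingLike.apply_eq_iff_eq]

/-- The tensor product of two schemes. -/
def prod (s : Scheme R ι τ) (s' : Scheme R κ υ) : Scheme R (ι × κ) (τ × υ) where
  α i j μ := s.α i.1 j.1 μ.1 * s'.α i.2 j.2 μ.2
  β i j μ := s.β i.1 j.1 μ.1 * s'.β i.2 j.2 μ.2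
  lam i j μ := s.lam i.1 j.1 μ.1 * s'.lam i.2 j.2 μ.2
  brent i j i' j' k l := by
    rw [Fintype.sum_prod_type]
    have h := congrArg₂ (· * ·) (s.brent i.1 j.1 i'.1 j'.1 k.1 l.1)
      (s'.brent i.2 j.2 i'.2 j'.2 k.2 l.2)
    simp only [Fintype.sum_mul_sum, ite_zero_mul_ite_zero, mul_one] at h
    convert h using 1
    · exact Fintype.sum_congr _ _ fun μ => Fintype.sum_congr _ _ fun ν => by ring
    · simp only [Prod.ext_iff]
      exact if_congr (by tauto) rfl rfl

/-- The tensor power of a scheme. -/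
def pow (κ : Type*) [Fintype κ] [DecidableEq κ] (s : Scheme R ι τ) :
    Scheme R (κ → ι) (κ → τ) where
  α i j μ := ∏ a, s.α (i a) (j a) (μ a)
  β i j μ := ∏ a, s.β (i a) (j a) (μ a)
  lam i j μ := ∏ a, s.lam (i a) (j a) (μ a)
  brent i j i' j' k l := by
    simp only [← Finset.prod_mul_distrib]
    rw [← Fintype.prod_sum fun a μ => s.lam (i a) (j a) μ * s.α (i' a) (j' a) μ * s.β (k a) (l a) μ]
    simp only [s.brent, Finset.prod_ite_zero, Finset.prod_const_one, funext_iff, forall_and,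
      Finset.mem_univ, true_imp_iff]

/-- The schoolbook scheme, with the products `A a c * B c b` indexed by `(a, c, b)`. -/
def schoolbook (R κ : Type*) [CommRing R] [DecidableEq κ] [Fintype κ] :
    Scheme R κ (κ × κ × κ) where
  α i j μ := if i = μ.1 ∧ j = μ.2.1 then 1 else 0
  β i j μ := if i = μ.2.2 ∧ j = μ.2.1 then 1 else 0
  lam i j μ := if i = μ.1 ∧ j = μ.2.2 then 1 else 0
  brent i j i' j' k l := by
    simp only [ite_zero_mul_ite_zero, mul_one]
    refine (Fintype.sum_eq_single (i, j', j) fun μ hμ => if_neg ?_).trans (if_congr ?_ rfl rfl)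
    · rintro ⟨⟨⟨rfl, rfl⟩, -, rfl⟩, -⟩
      exact hμ rfl
    · simp only [true_and, and_true, eq_comm, and_comm]

theorem exists_fin [Fintype ι] (s : Scheme R ι τ) {m t : ℕ} (hm : Fintype.card ι = m)
    (ht : Fintype.card τ = t) : Nonempty (Scheme R (Fin m) (Fin t)) :=
  ⟨s.comap (Fintype.equivFinOfCardEq hm).symm.toEmbedding (Fintype.equivFinOfCardEq ht).symm⟩

theorem card_sq_le [Nontrivial R] [Fintype ι] (s : Scheme R ι τ) :
    Fintype.card ι ^ 2 ≤ Fintype.card τ := by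
  have hli : LinearIndependent R fun (p : ι × ι) μ => s.α p.1 p.2 μ := by
    rw [Fintype.linearIndependent_iff]
    intro g hg q
    have hg' (μ : τ) : ∑ p, g p * s.α p.1 p.2 μ = 0 := by simpa using congrFun hg μ
    calc g q = ∑ p : ι × ι, g p * ∑ μ, s.lam q.1 q.1 μ * s.α p.1 p.2 μ * s.β q.1 q.2 μ := by
          simp [s.brent, Fintype.sum_prod_type, ite_and]
      _ = ∑ μ, s.lam q.1 q.1 μ * (∑ p, g p * s.α p.1 p.2 μ) * s.β q.1 q.2 μ := by
          simp only [Finset.mul_sum, Finset.sum_mul]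
          rw [Finset.sum_comm]
          exact Fintype.sum_congr _ _ fun μ => Fintype.sum_congr _ _ fun p => by ring
      _ = 0 := by simp [hg']
  simpa [sq] using hli.fintype_card_le_finrank

/-- The set of the coefficients of a scheme. -/
def coeffs (s : Scheme R ι τ) : Set R :=
  ⋃ (i) (j) (μ), {s.α i j μ, s.β i j μ, s.lam i j μ}

theorem finite_coeffs [Finite ι] (s : Scheme R ι τ) : s.coeffs.Finite :=
  Set.finite_iUnion fun _ => Set.finite_iUnion fun _ => Set.finite_iUnion fun _ => Set.toFinite _

theorem descend (s : Scheme S ι τ) {f : R →+* S} (hf : Function.Injective f)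
    (hs : s.coeffs ⊆ Set.range f) : Nonempty (Scheme R ι τ) := by
  have coeff_mem {c : S} (i j μ) (hc : c ∈ ({s.α i j μ, s.β i j μ, s.lam i j μ} : Set S)) :
      ∃ a, f a = c :=
    hs (Set.mem_iUnion.2 ⟨i, Set.mem_iUnion.2 ⟨j, Set.mem_iUnion.2 ⟨μ, hc⟩⟩⟩)
  choose α hα using fun i j μ => coeff_mem i j μ (Or.inl rfl)
  choose β hβ using fun i j μ => coeff_mem i j μ (Or.inr (Or.inl rfl))
  choose lam hlam using fun i j μ => coeff_mem i j μ (Or.inr (Or.inr rfl))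
  refine ⟨⟨α, β, lam, fun i j i' j' k l => hf ?_⟩⟩
  simp only [map_sum, map_mul, hα, hβ, hlam, s.brent, apply_ite f, map_one, map_zero]

/-- The restriction of scalars of a scheme along a free extension, with the linear forms split into
their coordinates in a basis and the result read off by a linear retraction of the extension. -/
noncomputable def restrictScalars [Algebra R S] [Fintype κ] (s : Scheme S ι τ)
    (B : Module.Basis κ R S) {φ : S →ₗ[R] R} (hφ : φ 1 = 1) : Scheme R ι (τ × κ × κ) where
  α i j μ := B.repr (s.α i j μ.1) μ.2.1
  β i j μ := B.repr (s.β i j μ.1) μ.2.2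
  lam i j μ := φ (s.lam i j μ.1 * B μ.2.1 * B μ.2.2)
  brent i j i' j' k l := by
    have split (μ : τ) : ∑ a, ∑ b, φ (s.lam i j μ * B a * B b) * B.repr (s.α i' j' μ) a *
        B.repr (s.β k l μ) b = φ (s.lam i j μ * s.α i' j' μ * s.β k l μ) := by
      conv_rhs => rw [← B.sum_repr (s.α i' j' μ), ← B.sum_repr (s.β k l μ)]
      simp only [Finset.mul_sum, Finset.sum_mul, map_sum]
      rw [Finset.sum_comm]
      refine Fintype.sum_congr _ _ fun b => Fintype.sum_congr _ _ fun a => ?_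
      rw [mul_smul_comm, mul_smul_comm, smul_mul_assoc, map_smul, map_smul, smul_eq_mul,
        smul_eq_mul]
      ring
    simp only [Fintype.sum_prod_type, split]
    rw [← map_sum, s.brent, apply_ite φ, hφ, map_zero]

end Scheme

theorem exists_ideal_isMaximal_finite_quotient (k : Type*) {A : Type*} [Field k] [CommRing A]
    [Nontrivial A] [Algebra k A] [Algebra.FiniteType k A] :
    ∃ I : Ideal A, I.IsMaximal ∧ Module.Finite k (A ⧸ I) := by
  obtain ⟨I, hI⟩ := Ideal.exists_maximal A
  let _ := Ideal.Quotient.field I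
  have := Algebra.FiniteType.of_surjective (Ideal.Quotient.mkₐ k I)
    (Ideal.Quotient.mkₐ_surjective k I)
  exact ⟨I, hI, finite_of_finite_type_of_isJacobsonRing k (A ⧸ I)⟩

namespace Scheme

variable {R ι τ : Type*} [CommRing R] [DecidableEq ι] [Fintype τ]

theorem exists_pow_baseField (k : Type*) {A : Type*} [Field k] [CommRing A] [Nontrivial A]
    [Algebra k A] [Finite ι] (s : Scheme A ι τ) :
    ∃ D : ℕ, ∀ r, Nonempty (Scheme k (Fin r → ι) ((Fin r → τ) × Fin D × Fin D)) := by
  let A₀ := Algebra.adjoin k s.coeffs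
  have hA₀ : s.coeffs ⊆ Set.range A₀.val := fun c hc => ⟨⟨c, Algebra.subset_adjoin hc⟩, rfl⟩
  obtain ⟨s₀⟩ := s.descend (f := (A₀.val : A₀ →+* A)) Subtype.val_injective hA₀
  have : Algebra.FiniteType k A₀ := .adjoin_of_finite s.finite_coeffs
  obtain ⟨I, hI, hfin⟩ := exists_ideal_isMaximal_finite_quotient k (A := A₀)
  let _ := Ideal.Quotient.field I
  obtain ⟨φ, hφ⟩ := (Algebra.linearMap k (A₀ ⧸ I)).exists_leftInverse_of_injective
    (LinearMap.ker_eq_bot.2 (algebraMap k (A₀ ⧸ I)).injective)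
  have hφ1 : φ 1 = 1 := by simpa using LinearMap.congr_fun hφ 1
  exact ⟨_, fun r => ⟨((s₀.map (Ideal.Quotient.mk I)).pow (Fin r)).restrictScalars
    (Module.finBasis k (A₀ ⧸ I)) hφ1⟩⟩

theorem exists_ne_zero_of_fractionRing {K : Type*} [Field K] [IsDomain R] [Algebra R K]
    [IsFractionRing R K] [Finite ι] (s : Scheme K ι τ) :
    ∃ d : R, d ≠ 0 ∧ ∀ {S : Type*} [CommRing S] (f : R →+* S), IsUnit (f d) →
      Nonempty (Scheme S ι τ) := by
  obtain ⟨d, hd⟩ := IsLocalization.exist_integer_multiples_of_finset (nonZeroDivisors R)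
    s.finite_coeffs.toFinset
  have hd0 : (d : R) ≠ 0 := nonZeroDivisors.ne_zero d.2
  refine ⟨d, hd0, fun f hf => ?_⟩
  have hdK : IsUnit (algebraMap R K d) := IsLocalization.map_units K d
  let ψ : Localization.Away (d : R) →+* K := IsLocalization.Away.lift (d : R) hdK
  have hψ : Function.Injective ψ := by
    have hinj := IsLocalization.injective (Localization.Away (d : R))
      (powers_le_nonZeroDivisors_of_noZeroDivisors hd0)
    exact (IsLocalization.lift_injective_iff _).2 fun x y =>
      hinj.eq_iff.trans (IsFractionRing.injective R K).eq_iff.symm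
  have hrange : s.coeffs ⊆ Set.range ψ := fun c hc => by
    obtain ⟨z, hz⟩ := hd c (s.finite_coeffs.mem_toFinset.2 hc)
    refine ⟨algebraMap R _ z * IsLocalization.Away.invSelf (d : R), ?_⟩
    have hψR (a : R) : ψ (algebraMap R _ a) = algebraMap R K a :=
      IsLocalization.Away.lift_eq (d : R) hdK a
    have hinv : algebraMap R K d * ψ (IsLocalization.Away.invSelf (d : R)) = 1 := by
      rw [← hψR, ← map_mul, IsLocalization.Away.mul_invSelf, map_one]
    rw [map_mul, hψR, hz, Algebra.smul_def]
    linear_combination c * hinv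
  obtain ⟨s₀⟩ := s.descend hψ hrange
  exact ⟨s₀.map (IsLocalization.Away.lift (d : R) hf)⟩

theorem exists_zmod [Finite ι] (s : Scheme ℚ ι τ) :
    ∃ D : ℕ, ∀ p : ℕ, p.Prime → D < p → Nonempty (Scheme (ZMod p) ι τ) := by
  obtain ⟨d, hd0, hd⟩ := s.exists_ne_zero_of_fractionRing (R := ℤ)
  refine ⟨d.natAbs, fun p hp hDp => ?_⟩
  have := Fact.mk hp
  refine hd (Int.castRingHom (ZMod p)) (Ne.isUnit fun h => ?_)
  have hdvd : (p : ℤ) ∣ d := (ZMod.intCast_zmod_eq_zero_iff_dvd d p).1 h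
  exact absurd (Nat.le_of_dvd (Int.natAbs_pos.2 hd0) (Int.natCast_dvd.1 hdvd)) (not_le.2 hDp)

/-- The scheme of an algebraic algorithm. -/
def ofAlgorithm {K : Type*} [Field K] {m t : ℕ} (a : AlgebraicAlgorithm K m m t) :
    Scheme K (Fin m) (Fin t) where
  α := a.α
  β := a.β
  lam := a.lam
  brent i j i' j' k l := by
    have hα (μ : Fin t) : ∑ x, ∑ y, a.α x y μ * Matrix.single i' j' (1 : K) x y = a.α i' j' μ := by
      simp [Matrix.single_apply, ite_and]
    have hβ (μ : Fin t) : ∑ x, ∑ y, a.β x y μ * Matrix.single l k (1 : K) y x = a.β k l μ := by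
      simp [Matrix.single_apply, ite_and]
    have h := a.correct (Matrix.single i' j' 1) (Matrix.single l k 1) i j
    simp only [hα, hβ] at h
    rw [← h]
    by_cases hjl : j' = l
    · subst hjl
      simp [Matrix.single_apply, eq_comm]
    · rw [Matrix.single_mul_single_of_ne _ _ _ _ hjl]
      simp [hjl]

/-- The algebraic algorithm of a scheme. -/
def toAlgorithm {K : Type*} [Field K] {m t : ℕ} (s : Scheme K (Fin m) (Fin t)) :
    AlgebraicAlgorithm K m m t where
  α := s.α
  β := s.β
  lam := s.lam
  correct A B i j := by simpa only [mul_assoc] using s.mul_apply A B i j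

end Scheme

section Exponent

variable (K : Type*) [Field K]

theorem exists_lt_rpow (C : ℝ) {δ : ℝ} (hδ : 0 < δ) : ∃ n : ℕ, 2 ≤ n ∧ C < (n : ℝ) ^ δ := by
  have h := (tendsto_rpow_atTop hδ).comp tendsto_natCast_atTop_atTop
  exact ((Filter.eventually_ge_atTop 2).and (h.eventually_gt_atTop C)).exists

variable {K} in
theorem exists_algorithm_of_mem_admissibleExponents {τ ε : ℝ} (hτ : τ ∈ admissibleExponents K)
    (hε : 0 < ε) :
    ∃ m t : ℕ, 2 ≤ m ∧ (t : ℝ) < (m : ℝ) ^ (τ + ε) ∧ Nonempty (AlgebraicAlgorithm K m m t) := by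
  obtain ⟨C, hC⟩ := hτ (ε / 2) (half_pos hε)
  obtain ⟨m, hm, hCm⟩ := exists_lt_rpow C (half_pos hε)
  obtain ⟨t, ht, ha⟩ := hC m (by omega)
  have hm0 : (0 : ℝ) < m := by exact_mod_cast zero_lt_two.trans_le hm
  refine ⟨m, t, hm, ?_, ha⟩
  calc (t : ℝ) ≤ C * (m : ℝ) ^ (τ + ε / 2) := ht
    _ < (m : ℝ) ^ (ε / 2) * (m : ℝ) ^ (τ + ε / 2) := by gcongr
    _ = (m : ℝ) ^ (τ + ε) := by rw [← Real.rpow_add hm0]; ring_nf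

theorem two_mem_lowerBounds_admissibleExponents : 2 ∈ lowerBounds (admissibleExponents K) := by
  intro τ hτ
  by_contra! hlt
  obtain ⟨m, t, -, ht, ⟨a⟩⟩ := exists_algorithm_of_mem_admissibleExponents hτ (sub_pos.2 hlt)
  have hsq : m ^ 2 ≤ t := by simpa using (Scheme.ofAlgorithm a).card_sq_le
  rw [add_sub_cancel, Real.rpow_two] at ht
  exact absurd (by exact_mod_cast ht : t < m ^ 2) (not_lt.2 hsq)

theorem three_mem_admissibleExponents : 3 ∈ admissibleExponents K := by
  refine fun ε hε => ⟨1, fun n hn => ?_⟩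
  obtain ⟨s⟩ := (Scheme.schoolbook K (Fin n)).exists_fin (m := n) (t := n * (n * n))
    (by simp) (by simp)
  refine ⟨_, ?_, ⟨s.toAlgorithm⟩⟩
  have hn1 : (1 : ℝ) ≤ n := by exact_mod_cast hn
  calc ((n * (n * n) : ℕ) : ℝ) = (n : ℝ) ^ (3 : ℝ) := by norm_cast; ring
    _ ≤ 1 * (n : ℝ) ^ (3 + ε) := by
      rw [one_mul]
      exact Real.rpow_le_rpow_of_exponent_le hn1 (by linarith)

theorem two_le_matMulExponent : 2 ≤ matMulExponent K :=
  le_csInf ⟨3, three_mem_admissibleExponents K⟩ (two_mem_lowerBounds_admissibleExponents K)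

theorem exists_algorithm_lt_rpow_matMulExponent {ε : ℝ} (hε : 0 < ε) :
    ∃ m t : ℕ, 2 ≤ m ∧ (t : ℝ) < (m : ℝ) ^ (matMulExponent K + ε) ∧
      Nonempty (AlgebraicAlgorithm K m m t) := by
  obtain ⟨τ, hτ, hlt⟩ := exists_lt_of_csInf_lt ⟨3, three_mem_admissibleExponents K⟩
    (lt_add_of_pos_right (matMulExponent K) hε)
  simpa using exists_algorithm_of_mem_admissibleExponents hτ (sub_pos.2 hlt)

theorem exists_scheme_baseField_le_rpow_matMulExponent (k : Type*) [Field k] [Algebra k K] {ε : ℝ}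
    (hε : 0 < ε) :
    ∃ m t : ℕ, 2 ≤ m ∧ (t : ℝ) ≤ (m : ℝ) ^ (matMulExponent K + ε) ∧
      Nonempty (Scheme k (Fin m) (Fin t)) := by
  obtain ⟨m, t, hm, ht, ⟨a⟩⟩ := exists_algorithm_lt_rpow_matMulExponent K (half_pos hε)
  obtain ⟨D, hD⟩ := (Scheme.ofAlgorithm a).exists_pow_baseField k
  have hm1 : (1 : ℝ) < m := by exact_mod_cast hm
  have hm0 : (0 : ℝ) < m := zero_lt_one.trans hm1
  -- A tensor power makes the constant factor `D ^ 2` negligible.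
  obtain ⟨r, hr⟩ := pow_unbounded_of_one_lt ((D : ℝ) * D) (Real.one_lt_rpow hm1 (half_pos hε))
  obtain ⟨s⟩ := hD (r + 1)
  refine ⟨m ^ (r + 1), t ^ (r + 1) * (D * D), hm.trans (Nat.le_self_pow r.succ_ne_zero m), ?_,
    s.exists_fin (by simp) (by simp)⟩
  have hr' : (D : ℝ) * D ≤ ((m : ℝ) ^ (ε / 2)) ^ (r + 1) :=
    hr.le.trans (pow_le_pow_right₀ (Real.one_le_rpow hm1.le (half_pos hε).le) r.le_succ)
  push_cast
  calc (t : ℝ) ^ (r + 1) * (D * D)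
      ≤ ((m : ℝ) ^ (matMulExponent K + ε / 2)) ^ (r + 1) * ((m : ℝ) ^ (ε / 2)) ^ (r + 1) := by
        gcongr
    _ = ((m : ℝ) ^ (matMulExponent K + ε)) ^ (r + 1) := by
        rw [← mul_pow, ← Real.rpow_add hm0, add_assoc, add_halves]
    _ = ((m : ℝ) ^ (r + 1)) ^ (matMulExponent K + ε) := by
        rw [← Real.rpow_natCast, ← Real.rpow_natCast, ← Real.rpow_mul hm0.le,
          ← Real.rpow_mul hm0.le, mul_comm]

end Exponent

/-- The truncation of an extended natural number at `W`: values above `W` are replaced by `⊤`. -/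
noncomputable def trunc (W : ℕ) (a : ℕ∞) : ℕ∞ := if a ≤ W then a else ⊤

section Trunc

variable {W : ℕ} {a b : ℕ∞}

theorem trunc_of_le (h : a ≤ W) : trunc W a = a := if_pos h

theorem trunc_of_lt (h : W < a) : trunc W a = ⊤ := if_neg (not_le.2 h)

theorem le_trunc (W : ℕ) (a : ℕ∞) : a ≤ trunc W a := by
  rcases le_or_gt a W with h | h
  · rw [trunc_of_le h]
  · rw [trunc_of_lt h]; exact le_top

theorem trunc_mono (W : ℕ) : Monotone (trunc W) := fun a b h => by
  rcases le_or_gt b W with hb | hb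
  · rw [trunc_of_le hb, trunc_of_le (h.trans hb)]; exact h
  · rw [trunc_of_lt hb]; exact le_top

theorem trunc_le_of_ne_top (h : trunc W a ≠ ⊤) : trunc W a ≤ W := by
  rcases le_or_gt a W with ha | ha
  · rwa [trunc_of_le ha]
  · exact absurd (trunc_of_lt ha) h

theorem trunc_trunc (W : ℕ) (a : ℕ∞) : trunc W (trunc W a) = trunc W a := by
  rcases le_or_gt a W with ha | ha
  · rw [trunc_of_le ha, trunc_of_le ha]
  · rw [trunc_of_lt ha, trunc_of_lt (ENat.natCast_lt_top W)]

theorem trunc_eq_trunc_of_le (h : a ≤ b) (h' : a ≤ W → b ≤ a) : trunc W b = trunc W a := by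
  rcases le_or_gt a W with ha | ha
  · rw [le_antisymm (h' ha) h]
  · rw [trunc_of_lt ha, trunc_of_lt (ha.trans_le h)]

/-- The code of a truncated value by an element of a finite type, which fits into messages. -/
noncomputable def encodeTrunc (W : ℕ) (a : ℕ∞) : Option (Fin (W + 1)) :=
  if a ≤ W then some (Fin.ofNat (W + 1) a.toNat) else none

/-- The truncated value with a given code. -/
def decodeTrunc (o : Option (Fin (W + 1))) : ℕ∞ := o.elim ⊤ fun i => ((i : ℕ) : ℕ∞)

theorem decodeTrunc_encodeTrunc (W : ℕ) (a : ℕ∞) : decodeTrunc (encodeTrunc W a) = trunc W a := by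
  unfold encodeTrunc trunc
  split_ifs with h
  · lift a to ℕ using ne_top_of_le_ne_top (ENat.natCast_ne_top W) h
    have ha : a < W + 1 := Nat.lt_succ_of_le (by exact_mod_cast h)
    simp [decodeTrunc, Nat.mod_eq_of_lt ha]
  · rfl

end Trunc

/-- The min-plus product of two matrices that are truncated at `W`. -/
noncomputable def minPlus {ι κ υ : Type*} (W : ℕ) (A : ι → κ → ℕ∞) (B : κ → υ → ℕ∞) (i : ι)
    (j : υ) : ℕ∞ :=
  ⨅ k, (trunc W (A i k) + trunc W (B k j))

theorem trunc_minPlus {ι κ υ : Type*} (W : ℕ) (A : ι → κ → ℕ∞) (B : κ → υ → ℕ∞) (i : ι)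
    (j : υ) : trunc (2 * W) (minPlus W A B i j) = minPlus W A B i j := by
  by_cases h : minPlus W A B i j = ⊤
  · rw [h, trunc_of_lt (ENat.natCast_lt_top _)]
  obtain ⟨k, hk⟩ := iInf_lt_iff.1 (lt_top_iff_ne_top.2 h)
  have hk' := ENat.add_lt_top.1 hk
  refine trunc_of_le ((iInf_le _ k).trans ?_)
  rw [two_mul, Nat.cast_add]
  exact add_le_add (trunc_le_of_ne_top hk'.1.ne) (trunc_le_of_ne_top hk'.2.ne)

section Interpolation

open Polynomial

variable {F ι κ υ : Type*}

open Classical in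
/-- The monomial `X ^ a`, with the convention `X ^ ⊤ = 0`. It turns min-plus algebra into
polynomial algebra: the trailing degree of a sum of such monomials is the least exponent. -/
noncomputable def tropicalMonomial (F : Type*) [Semiring F] (a : ℕ∞) : F[X] :=
  if a = ⊤ then 0 else X ^ a.toNat

section Semiring

variable [Semiring F]

theorem tropicalMonomial_top : tropicalMonomial F ⊤ = 0 := if_pos rfl

theorem tropicalMonomial_natCast (a : ℕ) : tropicalMonomial F a = X ^ a := by
  simp [tropicalMonomial]

theorem tropicalMonomial_add (a b : ℕ∞) :
    tropicalMonomial F (a + b) = tropicalMonomial F a * tropicalMonomial F b := by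
  induction a with
  | top => simp [tropicalMonomial_top]
  | coe a =>
    induction b with
    | top => simp [tropicalMonomial_top]
    | coe b => rw [← Nat.cast_add]; simp only [tropicalMonomial_natCast, pow_add]

theorem natDegree_tropicalMonomial_trunc_le (W : ℕ) (a : ℕ∞) :
    (tropicalMonomial F (trunc W a)).natDegree ≤ W := by
  rcases le_or_gt a W with h | h
  · lift a to ℕ using ne_top_of_le_ne_top (ENat.natCast_ne_top W) h
    rw [trunc_of_le h, tropicalMonomial_natCast]
    exact (natDegree_X_pow_le a).trans (by exact_mod_cast h)
  · simp [trunc_of_lt h, tropicalMonomial_top]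

theorem coeff_tropicalMonomial (a : ℕ∞) (k : ℕ) :
    (tropicalMonomial F a).coeff k = if a = k then 1 else 0 := by
  induction a with
  | top => simp [tropicalMonomial_top]
  | coe a => simp [tropicalMonomial_natCast, coeff_X_pow, eq_comm]

theorem trailingDegree_sum_tropicalMonomial [Fintype κ]
    (hF : ∀ m : ℕ, 0 < m → m ≤ Fintype.card κ → (m : F) ≠ 0) (c : κ → ℕ∞) :
    (∑ w, tropicalMonomial F (c w)).trailingDegree = ⨅ w, c w := by
  have coeff_ne_zero_iff (k : ℕ) :
      (∑ w, tropicalMonomial F (c w)).coeff k ≠ 0 ↔ ∃ w, c w = k := by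
    have hcoeff : (∑ w, tropicalMonomial F (c w)).coeff k =
        ((Finset.univ.filter fun w => c w = k).card : F) := by
      simp [finsetSum_coeff, coeff_tropicalMonomial]
    rw [hcoeff]
    refine ⟨fun h => ?_, fun ⟨w, hw⟩ => hF _ (Finset.card_pos.2 ⟨w, by simp [hw]⟩)
      (Finset.card_le_univ _)⟩
    by_contra! hne
    exact h (by simp [hne])
  refine le_antisymm (le_iInf fun w => ?_) ?_
  · induction hw : c w with
    | top => exact le_top
    | coe k => exact trailingDegree_le_of_ne_zero ((coeff_ne_zero_iff k).2 ⟨w, hw⟩)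
  · refine Finset.le_min fun k hk => ?_
    obtain ⟨w, hw⟩ := (coeff_ne_zero_iff k).1 (mem_support_iff.1 hk)
    exact (iInf_le c w).trans_eq hw

end Semiring

theorem minPlus_eq_trailingDegree_interpolate [Field F] [Fintype κ] {W : ℕ}
    (hF : ∀ m : ℕ, 0 < m → m ≤ Fintype.card κ → (m : F) ≠ 0) {pt : Fin (2 * W + 1) → F}
    (hpt : Function.Injective pt) (A : ι → κ → ℕ∞) (B : κ → υ → ℕ∞) (i : ι) (j : υ) :
    minPlus W A B i j = (Lagrange.interpolate Finset.univ pt fun q =>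
      ∑ k, (tropicalMonomial F (trunc W (A i k))).eval (pt q) *
        (tropicalMonomial F (trunc W (B k j))).eval (pt q)).trailingDegree := by
  let f : F[X] := ∑ k, tropicalMonomial F (trunc W (A i k)) * tropicalMonomial F (trunc W (B k j))
  have hdeg : f.natDegree ≤ 2 * W := natDegree_sum_le_of_forall_le _ _ fun k _ => by
    rw [two_mul]
    exact natDegree_mul_le_of_le (natDegree_tropicalMonomial_trunc_le W _)
      (natDegree_tropicalMonomial_trunc_le W _)
  have hinterp : f = Lagrange.interpolate Finset.univ pt fun q => f.eval (pt q) :=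
    Lagrange.eq_interpolate hpt.injOn <| (degree_le_of_natDegree_le hdeg).trans_lt <| by
      rw [Finset.card_univ, Fintype.card_fin]
      exact_mod_cast Nat.lt_succ_self _
  calc minPlus W A B i j = f.trailingDegree := by
        simp only [f, ← tropicalMonomial_add]
        exact (trailingDegree_sum_tropicalMonomial hF _).symm
    _ = _ := by
        rw [hinterp]
        simp only [f, eval_finsetSum, eval_mul]

end Interpolation

section BlockProduct

variable {R ι κ τ V : Type*} [CommRing R] [DecidableEq ι] [DecidableEq κ] [Fintype τ] [Fintype V]

/-- The linear form `μ` of the left factor in the scheme `s`, applied to the block `(a, c)` of `A`.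
The row and column `v` of `A` have position `(blk v).1` in the block with number `(blk v).2`. -/
def Scheme.leftForm (s : Scheme R ι τ) (blk : V → ι × κ) (a c : κ) (μ : τ) (A : Matrix V V R) : R :=
  ∑ u, ∑ v, if (blk u).2 = a ∧ (blk v).2 = c then s.α (blk u).1 (blk v).1 μ * A u v else 0

/-- The linear form `μ` of the right factor in the scheme `s`, applied to the block `(c, b)` of `B`.
The row and column `v` of `B` have position `(blk v).1` in the block with number `(blk v).2`. -/
def Scheme.rightForm (s : Scheme R ι τ) (blk : V → ι × κ) (c b : κ) (μ : τ) (B : Matrix V V R) :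
    R :=
  ∑ v, ∑ u, if (blk v).2 = b ∧ (blk u).2 = c then s.β (blk v).1 (blk u).1 μ * B u v else 0

theorem Scheme.leftForm_congr (s : Scheme R ι τ) (blk : V → ι × κ) {a c : κ} (μ : τ)
    {A A' : Matrix V V R} (h : ∀ u v, ((blk u).2, (blk v).2) = (a, c) → A u v = A' u v) :
    s.leftForm blk a c μ A = s.leftForm blk a c μ A' :=
  Fintype.sum_congr _ _ fun u => Fintype.sum_congr _ _ fun v =>
    ite_congr rfl (fun huv => by rw [h u v (Prod.ext huv.1 huv.2)]) fun _ => rfl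

theorem Scheme.rightForm_congr (s : Scheme R ι τ) (blk : V → ι × κ) {c b : κ} (μ : τ)
    {B B' : Matrix V V R} (h : ∀ u v, ((blk u).2, (blk v).2) = (c, b) → B u v = B' u v) :
    s.rightForm blk c b μ B = s.rightForm blk c b μ B' :=
  Fintype.sum_congr _ _ fun v => Fintype.sum_congr _ _ fun u =>
    ite_congr rfl (fun hvu => by rw [h u v (Prod.ext hvu.2 hvu.1)]) fun _ => rfl

theorem Scheme.block_mul_apply [Fintype κ] (s : Scheme R ι τ) (blk : V ↪ ι × κ)
    (A B : Matrix V V R) (i j : V) :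
    ∑ μ, s.lam (blk i).1 (blk j).1 μ *
      ∑ c, s.leftForm blk (blk i).2 c μ A * s.rightForm blk c (blk j).2 μ B = (A * B) i j := by
  classical
  rw [((s.prod (schoolbook R κ)).comap blk (Equiv.refl _)).mul_apply A B i j]
  simp only [comap, prod, schoolbook, leftForm, rightForm, Fintype.sum_prod_type, Equiv.refl_apply]
  simp only [mul_ite, ite_mul, mul_one, mul_zero, zero_mul, ite_and, Finset.sum_ite_irrel,
    Finset.sum_const_zero, Finset.sum_ite_eq, Finset.mem_univ, if_true]
  exact Fintype.sum_congr _ _ fun μ => Finset.mul_sum _ _ _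

end BlockProduct

section Distributed

variable {n b w r L : ℕ} {F V V' Q ι κ τ : Type} [CommRing F] [Fintype Q] [DecidableEq ι]
  [Fintype κ] [Fintype τ]

theorem computes_blockForms [DecidableEq κ] [Fintype F] [Fintype V] [Inhabited V]
    (s : Scheme F ι τ) (blk : Fin n ↪ ι × κ)
    {H : κ × κ → Fin n} {N : Q × τ → Fin n} (ev : Q → V → F)
    (hn : LoadLE (Prod.fst : Fin n × Fin n → Fin n) L)
    (hH : LoadLE (fun p : Fin n × Fin n => H ((blk p.1).2, (blk p.2).2)) L)
    (hHN : LoadLE (fun p : (κ × κ) × Q × τ => H p.1) L)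
    (hN : LoadLE (fun p : (κ × κ) × Q × τ => N p.2) L) (hL : 2 * L ≤ n * r)
    (hV : Fintype.card (V × V) ≤ 2 ^ (b * w)) (hF : Fintype.card (F × F) ≤ 2 ^ (b * w)) :
    Computes n b (2 * (w * r) + 2 * (w * r)) fun (x : Fin n → (Fin n → V) × (Fin n → V)) i
      (p : (κ × κ) × Q × τ) => if N p.2 = i then
        (s.leftForm blk p.1.1 p.1.2 p.2.2 fun u v => ev p.2.1 ((x u).1 v),
          s.rightForm blk p.1.1 p.1.2 p.2.2 fun u v => ev p.2.1 ((x u).2 v)) else 0 := by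
  let _ : Inhabited (F × F) := ⟨0⟩
  have gather := Computes.route hV hn hH hL fun p (z : (Fin n → V) × (Fin n → V)) =>
    (z.1 p.2, z.2 p.2)
  have spread := Computes.route hF hHN hN hL fun p (z : Fin n × Fin n → V × V) =>
    (s.leftForm blk p.1.1 p.1.2 p.2.2 fun u v => ev p.2.1 (z (u, v)).1,
      s.rightForm blk p.1.1 p.1.2 p.2.2 fun u v => ev p.2.1 (z (u, v)).2)
  refine (spread.comp gather).congr fun x i => funext fun p => ?_
  refine if_congr Iff.rfl (Prod.ext (s.leftForm_congr blk _ fun u v huv => ?_)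
    (s.rightForm_congr blk _ fun u v huv => ?_)) rfl <;> simp only [huv, if_true]

theorem computes_of_blockForms [Fintype F] [Fintype V'] [Inhabited V'] (s : Scheme F ι τ)
    (blk : Fin n ↪ ι × κ)
    {H : κ × κ → Fin n} {N : Q × τ → Fin n} (read : (Q → F) → V')
    (hn : LoadLE (Prod.fst : Fin n × Fin n → Fin n) L)
    (hH : LoadLE (fun p : Fin n × Fin n => H ((blk p.1).2, (blk p.2).2)) L)
    (hHN : LoadLE (fun p : (κ × κ) × Q × τ => H p.1) L)
    (hN : LoadLE (fun p : (κ × κ) × Q × τ => N p.2) L) (hL : 2 * L ≤ n * r)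
    (hV' : Fintype.card V' ≤ 2 ^ (b * w)) (hF : Fintype.card F ≤ 2 ^ (b * w)) :
    Computes n b (2 * (w * r) + 2 * (w * r)) fun (z : Fin n → (κ × κ) × Q × τ → F × F) i j =>
      read fun q => ∑ μ, s.lam (blk i).1 (blk j).1 μ * ∑ c,
        (z (N (q, μ)) (((blk i).2, c), q, μ)).1 * (z (N (q, μ)) ((c, (blk j).2), q, μ)).2 := by
  let _ : Inhabited F := ⟨0⟩
  have gather := Computes.route hF hN hHN hL fun p (z : (κ × κ) × Q × τ → F × F) =>
    ∑ c, (z ((p.1.1, c), p.2)).1 * (z ((c, p.1.2), p.2)).2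
  have spread := Computes.route hV' hH hn hL fun p (z : (κ × κ) × Q × τ → F) =>
    read fun q => ∑ μ, s.lam (blk p.1).1 (blk p.2).1 μ * z (((blk p.1).2, (blk p.2).2), q, μ)
  exact ((Computes.of_local fun i (z : Fin n × Fin n → V') j => z (i, j)).comp
    (spread.comp gather)).congr fun z i => funext fun j => by simp only [if_true]

theorem computes_batchedProduct [Fintype ι] [Fintype F] [Fintype V]
    [Inhabited V] [Fintype V'] [Inhabited V'] (hn : 0 < n) (s : Scheme F ι τ)
    (blk : Fin n ↪ ι × κ) (ev : Q → V → F)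
    (read : (Q → F) → V') (hF : Fintype.card (F × F) ≤ 2 ^ (b * w))
    (hV : Fintype.card (V × V) ≤ 2 ^ (b * w)) (hV' : Fintype.card V' ≤ 2 ^ (b * w)) (hnL : n ≤ L)
    (hιL : (Fintype.card (κ × κ) / n + 1) * Fintype.card (ι × ι) ≤ L)
    (hτL : (Fintype.card (κ × κ) / n + 1) * Fintype.card (Q × τ) ≤ L)
    (hκL : (Fintype.card (Q × τ) / n + 1) * Fintype.card (κ × κ) ≤ L) (hL : 2 * L ≤ n * r) :
    Computes n b (8 * (w * r)) fun (x : Fin n → (Fin n → V) × (Fin n → V)) i j =>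
      read fun q => ∑ v, ev q ((x i).1 v) * ev q ((x v).2 j) := by
  classical
  -- The node `H (a, c)` collects the blocks numbered `(a, c)` of all matrices, and the node
  -- `N (q, μ)` multiplies the block forms of product `μ` of the scheme for the index `q`.
  obtain ⟨H, hH⟩ := LoadLE.exists_fin (κ × κ) hn
  obtain ⟨N, hN⟩ := LoadLE.exists_fin (Q × τ) hn
  have load_row : LoadLE (Prod.fst : Fin n × Fin n → Fin n) L := by
    have load_id : LoadLE (id : Fin n → Fin n) 1 := fun v => by simp [Finset.filter_eq']
    exact (load_id.of_injective_fst Function.injective_id).mono (by simpa using hnL)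
  have load_block : LoadLE (fun p : Fin n × Fin n => H ((blk p.1).2, (blk p.2).2)) L := by
    refine (hH.of_injective_fst (φ := fun p : Fin n × Fin n =>
      (((blk p.1).2, (blk p.2).2), ((blk p.1).1, (blk p.2).1))) fun p p' h => ?_).mono hιL
    simp only [Prod.mk.injEq] at h
    exact Prod.ext (blk.injective (Prod.ext h.2.1 h.1.1)) (blk.injective (Prod.ext h.2.2 h.1.2))
  have load_H : LoadLE (fun p : (κ × κ) × Q × τ => H p.1) L :=
    (hH.of_injective_fst Function.injective_id).mono hτL
  have load_N : LoadLE (fun p : (κ × κ) × Q × τ => N p.2) L :=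
    (hN.of_injective_fst Prod.swap_injective).mono hκL
  have forms := computes_blockForms s blk ev load_row load_block load_H load_N hL hV hF
  have products := computes_of_blockForms s blk read load_row load_block load_H load_N hL hV' (by
    refine le_trans ?_ hF
    rw [Fintype.card_prod]
    exact Nat.le_mul_self _)
  rw [show 8 * (w * r) = 2 * (w * r) + 2 * (w * r) + (2 * (w * r) + 2 * (w * r)) by ring]
  refine (products.comp forms).congr fun x i => funext fun j => ?_
  simp only [if_true]
  exact congrArg read <| funext fun q =>
    s.block_mul_apply blk (fun u v => ev q ((x u).1 v)) (fun u v => ev q ((x u).2 v)) i j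

end Distributed

/-- Some protocol with `R` rounds of `b`-bit messages computes min-plus products of matrices,
truncated at `W`, where every node is given its rows of the two factors. -/
def ComputesMinPlus (n b R W : ℕ) : Prop :=
  Computes n b R fun (x : Fin n → (Fin n → ℕ∞) × (Fin n → ℕ∞)) =>
    minPlus W (fun u => (x u).1) (fun u => (x u).2)

theorem computesMinPlus {n b w r L W : ℕ} {F ι κ τ : Type} [Field F] [Fintype F] [Fintype ι]
    [DecidableEq ι] [Fintype κ] [Fintype τ] (hn : 0 < n) (s : Scheme F ι τ)
    (blk : Fin n ↪ ι × κ) (hW : 1 ≤ W) (hF : ∀ m : ℕ, 0 < m → m ≤ n → (m : F) ≠ 0)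
    (hFW : 2 * W + 1 ≤ Fintype.card F) (hFw : Fintype.card (F × F) ≤ 2 ^ (b * w)) (hnL : n ≤ L)
    (hιL : (Fintype.card (κ × κ) / n + 1) * Fintype.card (ι × ι) ≤ L)
    (hτL : (Fintype.card (κ × κ) / n + 1) * ((2 * W + 1) * Fintype.card τ) ≤ L)
    (hκL : ((2 * W + 1) * Fintype.card τ / n + 1) * Fintype.card (κ × κ) ≤ L)
    (hL : 2 * L ≤ n * r) :
    ComputesMinPlus n b (8 * (w * r)) W := by
  obtain ⟨pt⟩ : Nonempty (Fin (2 * W + 1) ↪ F) :=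
    Function.Embedding.nonempty_of_card_le (by rwa [Fintype.card_fin])
  have hV : Fintype.card (Option (Fin (W + 1)) × Option (Fin (W + 1))) ≤ 2 ^ (b * w) := by
    refine le_trans ?_ hFw
    simp only [Fintype.card_prod, Fintype.card_option, Fintype.card_fin]
    exact Nat.mul_le_mul (by omega) (by omega)
  have hV' : Fintype.card (Option (Fin (2 * W + 1))) ≤ 2 ^ (b * w) := by
    refine le_trans ?_ hFw
    simp only [Fintype.card_prod, Fintype.card_option, Fintype.card_fin]
    nlinarith
  have product := computes_batchedProduct (b := b) (w := w) hn s blk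
    (fun q (o : Option (Fin (W + 1))) => (tropicalMonomial F (decodeTrunc o)).eval (pt q))
    (fun z => encodeTrunc (2 * W) (Lagrange.interpolate Finset.univ pt z).trailingDegree)
    hFw hV hV' hnL hιL (by simpa using hτL) (by simpa using hκL) hL
  refine (product.dimap (fun s : (Fin n → ℕ∞) × (Fin n → ℕ∞) =>
    (encodeTrunc W ∘ s.1, encodeTrunc W ∘ s.2)) fun _ o j => decodeTrunc (o j)).congr
      fun x i => funext fun j => ?_
  simp only [Function.comp_apply, decodeTrunc_encodeTrunc]
  rw [← minPlus_eq_trailingDegree_interpolate (by rwa [Fintype.card_fin]) pt.injective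
    (fun u => (x u).1) (fun u => (x u).2), trunc_minPlus]

/-- The offset `d - T` of a distance `d` from a centre `T`, shifted and truncated to the interval
`{0, …, 4 * M}`: an offset from `-2 * M` to `2 * M` is represented exactly, a smaller one by `0` and
a larger one by `⊤`. -/
noncomputable def window (M T : ℕ) (d : ℕ∞) : ℕ∞ := trunc (4 * M) (d + (2 * M : ℕ) - T)

section Window

variable {M T : ℕ}

theorem window_mono (M T : ℕ) : Monotone (window M T) := fun _ _ h =>
  trunc_mono _ (tsub_le_tsub_right (add_le_add_left h _) _)

theorem window_top (M T : ℕ) : window M T ⊤ = ⊤ := by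
  rw [window, top_add, ENat.top_sub_natCast, trunc_of_lt (ENat.natCast_lt_top _)]

theorem le_window (M T : ℕ) (d : ℕ∞) : d + (2 * M : ℕ) - T ≤ window M T d := le_trunc _ _

theorem window_natCast {d : ℕ} (h : d ≤ T + 2 * M) : window M T d = (d + 2 * M - T : ℕ) := by
  rw [window, ← Nat.cast_add, ← ENat.natCast_sub, trunc_of_le]
  norm_cast
  omega

theorem lt_window_iff {d : ℕ∞} : ((2 * M : ℕ) : ℕ∞) < window M T d ↔ (T : ℕ∞) < d := by
  constructor
  · intro h
    by_contra! hd
    refine absurd (h.trans_le (window_mono M T hd)) (not_lt.2 ?_)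
    rw [window_natCast (Nat.le_add_right T _), Nat.add_sub_cancel_left]
  · refine fun hd => lt_of_lt_of_le ?_ (le_window M T d)
    induction d with
    | top => exact ENat.natCast_lt_top _
    | coe d => norm_cast at hd ⊢; omega

theorem window_add_tsub {d : ℕ∞} (h : (T : ℕ∞) ≤ d) (h' : d ≠ ⊤ → d ≤ (T + M : ℕ)) :
    window M T d + T - (2 * M : ℕ) = d := by
  induction d with
  | top => rw [window_top, top_add, ENat.top_sub_natCast]
  | coe d =>
    have hd := h' (ENat.natCast_ne_top d)
    norm_cast at h hd
    rw [window_natCast (by omega)]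
    norm_cast
    omega

end Window

/-- Min-plus squaring of a matrix of which every node stores a row. -/
noncomputable def squareStep {n : ℕ} (W : ℕ) (x : Fin n → Fin n → ℕ∞) : Fin n → Fin n → ℕ∞ :=
  minPlus W x x

namespace WeightedGraph

variable {n M : ℕ} (G : WeightedGraph n M)

theorem walkLength_nil {u : Fin n} : G.walkLength (.nil : G.graph.Walk u u) = 0 := rfl

theorem walkLength_cons {u v w : Fin n} (h : G.graph.Adj u v) (p : G.graph.Walk v w) :
    G.walkLength (.cons h p) = G.weight u v + G.walkLength p := by
  simp [walkLength]

theorem walkLength_append {u v w : Fin n} (p : G.graph.Walk u v) (q : G.graph.Walk v w) :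
    G.walkLength (p.append q) = G.walkLength p + G.walkLength q := by
  simp [walkLength, SimpleGraph.Walk.darts_append]

theorem walkLength_le_length_mul {u v : Fin n} (p : G.graph.Walk u v) :
    G.walkLength p ≤ p.length * M := by
  rw [walkLength, ← p.length_darts, ← List.length_map (as := p.darts)]
  refine List.sum_le_card_nsmul _ _ fun a ha => ?_
  obtain ⟨d, -, rfl⟩ := List.mem_map.1 ha
  exact G.weight_le _ _ d.adj

theorem walkLength_bypass_le {u v : Fin n} (p : G.graph.Walk u v) :
    G.walkLength p.bypass ≤ G.walkLength p :=
  (p.darts_bypass_sublist_darts.map _).sum_le_sum fun _ _ => Nat.zero_le _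

theorem exists_split_walkLength {u v : Fin n} (p : G.graph.Walk u v) (h : ℕ) :
    ∃ (w : Fin n) (q : G.graph.Walk u w) (r : G.graph.Walk w v),
      G.walkLength q + G.walkLength r = G.walkLength p ∧ G.walkLength q ≤ h ∧
        (G.walkLength r = 0 ∨ h < G.walkLength q + M) := by
  induction p generalizing h with
  | nil => exact ⟨_, .nil, .nil, rfl, Nat.zero_le h, Or.inl rfl⟩
  | @cons u v _ e p ih =>
    have hM := G.weight_le u v e
    by_cases he : G.weight u v ≤ h
    · obtain ⟨w, q, r, hsum, hle, hlt⟩ := ih (h - G.weight u v)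
      refine ⟨w, .cons e q, r, ?_⟩
      simp only [walkLength_cons]
      omega
    · refine ⟨_, .nil, .cons e p, ?_⟩
      simp only [walkLength_nil]
      omega

theorem exists_split_length {u v : Fin n} (p : G.graph.Walk u v) {a b : ℕ}
    (h : p.length ≤ a + b) :
    ∃ (w : Fin n) (q : G.graph.Walk u w) (r : G.graph.Walk w v),
      G.walkLength q + G.walkLength r = G.walkLength p ∧ q.length ≤ a ∧ r.length ≤ b := by
  refine ⟨_, p.take a, p.drop a, ?_, ?_, ?_⟩
  · rw [← walkLength_append, p.append_take_drop_eq]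
  · rw [p.take_length]; exact min_le_left _ _
  · rw [p.drop_length]; omega

theorem dist_le_walkLength {u v : Fin n} (p : G.graph.Walk u v) : G.dist u v ≤ G.walkLength p :=
  iInf_le _ p

theorem exists_walkLength_eq_dist {u v : Fin n} (h : G.dist u v ≠ ⊤) :
    ∃ p : G.graph.Walk u v, p.length ≤ n ∧ (G.walkLength p : ℕ∞) = G.dist u v := by
  have : Nonempty (G.graph.Walk u v) := by
    by_contra hempty
    rw [not_nonempty_iff] at hempty
    exact h (iInf_of_empty _)
  obtain ⟨p, hp⟩ := ciInf_mem fun p : G.graph.Walk u v => (G.walkLength p : ℕ∞)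
  refine ⟨p.bypass, ?_, le_antisymm ?_ (G.dist_le_walkLength _)⟩
  · simpa using p.bypass_isPath.length_lt.le
  · exact (Nat.cast_le.2 (G.walkLength_bypass_le p)).trans hp.le

theorem dist_self (u : Fin n) : G.dist u u = 0 :=
  nonpos_iff_eq_zero.1 (G.dist_le_walkLength .nil)

theorem dist_triangle (u w v : Fin n) : G.dist u v ≤ G.dist u w + G.dist w v := by
  unfold dist
  refine ENat.le_iInf_add_iInf fun p q => ?_
  rw [← Nat.cast_add, ← walkLength_append]
  exact G.dist_le_walkLength _

theorem exists_dist_add_dist_eq {u v : Fin n} {d : ℕ} (hd : G.dist u v = d) (h : ℕ) :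
    ∃ (w : Fin n) (y z : ℕ), G.dist u w = y ∧ G.dist w v = z ∧ y + z = d ∧ y ≤ h ∧
      (z = 0 ∨ h < y + M) := by
  obtain ⟨p, -, hp⟩ := G.exists_walkLength_eq_dist (hd.trans_ne (ENat.natCast_ne_top d))
  obtain ⟨w, q, r, hsum, hle, hlt⟩ := G.exists_split_walkLength p h
  have hq := G.dist_le_walkLength q
  have hr := G.dist_le_walkLength r
  have htri := G.dist_triangle u w v
  lift G.dist u w to ℕ using ne_top_of_le_ne_top (ENat.natCast_ne_top _) hq with y hy
  lift G.dist w v to ℕ using ne_top_of_le_ne_top (ENat.natCast_ne_top _) hr with z hz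
  rw [hd] at hp htri
  norm_cast at hp hq hr htri
  exact ⟨w, y, z, hy.symm, hz.symm, by omega⟩

theorem window_dist_add_le_minPlus (S T : ℕ) (u v : Fin n) :
    G.dist u v + (2 * M : ℕ) - (S + T : ℕ) ≤
      minPlus (4 * M) (fun u v => window M S (G.dist u v)) (fun u v => window M T (G.dist u v))
        u v - (2 * M : ℕ) := by
  by_cases h0 : G.dist u v + (2 * M : ℕ) - (S + T : ℕ) = 0
  · exact h0.trans_le zero_le
  refine ENat.le_sub_of_add_le_right (ENat.natCast_ne_top _) (le_iInf fun w => ?_)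
  refine le_trans ?_ (add_le_add ((le_window M S _).trans (le_trunc _ _))
    ((le_window M T _).trans (le_trunc _ _)))
  have htri := G.dist_triangle u w v
  generalize G.dist u w = y at htri ⊢
  generalize G.dist w v = z at htri ⊢
  induction y with
  | top => simp
  | coe y =>
    induction z with
    | top => simp
    | coe z =>
      lift G.dist u v to ℕ using ne_top_of_le_ne_top (ENat.natCast_ne_top (y + z)) htri with x
      norm_cast at h0 htri ⊢
      omega

theorem minPlus_window_dist_le {S T : ℕ} {u v : Fin n}
    (h : G.dist u v + (2 * M : ℕ) - (S + T : ℕ) ≤ (4 * M : ℕ)) :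
    minPlus (4 * M) (fun u v => window M S (G.dist u v)) (fun u v => window M T (G.dist u v)) u v -
      (2 * M : ℕ) ≤ G.dist u v + (2 * M : ℕ) - (S + T : ℕ) := by
  induction hd : G.dist u v with
  | top => rw [top_add, ENat.top_sub_natCast]; exact le_top
  | coe d =>
    rw [hd] at h
    norm_cast at h
    -- A vertex `w` for which both `dist u w - S` and `dist w v - T` are close to half the offset
    -- `d - S - T`, so that both are represented in the windows.
    obtain ⟨w, y, z, hy, hz, hsum, hle, hlt⟩ := G.exists_dist_add_dist_eq hd ((d + S - T) / 2)
    refine (tsub_le_tsub_right (iInf_le _ w) _).trans ?_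
    simp only [hy, hz]
    rw [window_natCast (by omega), window_natCast (by omega),
      trunc_of_le (by norm_cast; omega), trunc_of_le (by norm_cast; omega)]
    norm_cast
    omega

theorem window_add (S T : ℕ) (u v : Fin n) :
    window M (S + T) (G.dist u v) = trunc (4 * M) (minPlus (4 * M)
      (fun u v => window M S (G.dist u v)) (fun u v => window M T (G.dist u v)) u v -
        (2 * M : ℕ)) :=
  (trunc_eq_trunc_of_le (G.window_dist_add_le_minPlus S T u v)
    G.minPlus_window_dist_le).symm

/-- The adjacency matrix with zeros on the diagonal, i.e. the least lengths of walks with at most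
one edge. -/
noncomputable def reflAdjMatrix (u v : Fin n) : ℕ∞ := if v = u then 0 else G.adjMatrix u v

theorem dist_le_reflAdjMatrix (u v : Fin n) : G.dist u v ≤ G.reflAdjMatrix u v := by
  unfold reflAdjMatrix adjMatrix
  split_ifs with hvu huv
  · rw [hvu, dist_self]
  · exact G.dist_le_walkLength (.cons huv .nil)
  · exact le_top

theorem reflAdjMatrix_le_walkLength {u v : Fin n} (p : G.graph.Walk u v) (hp : p.length ≤ 1) :
    G.reflAdjMatrix u v ≤ G.walkLength p := by
  match p with
  | .nil => simp [reflAdjMatrix]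
  | .cons e .nil => simp [reflAdjMatrix, adjMatrix, walkLength, e, e.ne']
  | .cons _ (.cons _ _) => simp at hp

theorem dist_le_iterate_squareStep (W k : ℕ) (u v : Fin n) :
    G.dist u v ≤ (squareStep W)^[k] G.reflAdjMatrix u v := by
  induction k generalizing u v with
  | zero => exact G.dist_le_reflAdjMatrix u v
  | succ k ih =>
    rw [Function.iterate_succ_apply']
    exact le_iInf fun w => (G.dist_triangle u w v).trans
      (add_le_add ((ih u w).trans (le_trunc _ _)) ((ih w v).trans (le_trunc _ _)))

theorem iterate_squareStep_le_walkLength {W k : ℕ} {u v : Fin n} (p : G.graph.Walk u v)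
    (hp : p.length ≤ 2 ^ k) (hW : G.walkLength p ≤ W) :
    (squareStep W)^[k] G.reflAdjMatrix u v ≤ G.walkLength p := by
  induction k generalizing u v with
  | zero => exact G.reflAdjMatrix_le_walkLength p hp
  | succ k ih =>
    obtain ⟨w, q, r, hsum, hq, hr⟩ := G.exists_split_length p (hp.trans_eq (Nat.two_pow_succ k))
    have hq' := ih q hq (by omega)
    have hr' := ih r hr (by omega)
    rw [Function.iterate_succ_apply', ← hsum, Nat.cast_add]
    refine (iInf_le _ w).trans ?_
    rw [trunc_of_le (hq'.trans (Nat.cast_le.2 (by omega))),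
      trunc_of_le (hr'.trans (Nat.cast_le.2 (by omega)))]
    exact add_le_add hq' hr'

theorem window_iterate_squareStep {k T : ℕ} (hk : n ≤ 2 ^ k) (hT : T ≤ 2 * M) (u v : Fin n) :
    window M T ((squareStep (4 * M))^[k] G.reflAdjMatrix u v) = window M T (G.dist u v) := by
  have dist_le := G.dist_le_iterate_squareStep (4 * M) k u v
  refine trunc_eq_trunc_of_le (tsub_le_tsub_right (add_le_add_left dist_le _) _) fun h => ?_
  refine tsub_le_tsub_right (add_le_add_left ?_ _) _
  by_cases hd : G.dist u v = ⊤
  · rw [hd]; exact le_top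
  obtain ⟨p, hlen, hp⟩ := G.exists_walkLength_eq_dist hd
  rw [← hp] at h ⊢
  norm_cast at h
  exact G.iterate_squareStep_le_walkLength p (hlen.trans hk) (by omega)

theorem dist_le_diameter (u v : Fin n) : G.dist u v ≤ G.diameter := le_iSup₂_of_le u v le_rfl

theorem exists_dist_eq_diameter (hn : 0 < n) : ∃ u v, G.dist u v = G.diameter := by
  have : Nonempty (Fin n) := ⟨⟨0, hn⟩⟩
  obtain ⟨u, hu⟩ := exists_eq_ciSup_of_finite (f := fun u => ⨆ v, G.dist u v)
  obtain ⟨v, hv⟩ := exists_eq_ciSup_of_finite (f := fun v => G.dist u v)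
  exact ⟨u, v, hv.trans hu⟩

theorem diameter_le (h : G.diameter ≠ ⊤) : G.diameter ≤ (n * M : ℕ) := by
  refine iSup₂_le fun u v => ?_
  obtain ⟨p, hlen, hp⟩ := G.exists_walkLength_eq_dist
    (ne_top_of_le_ne_top h (G.dist_le_diameter u v))
  rw [← hp]
  exact Nat.cast_le.2 ((G.walkLength_le_length_mul p).trans (Nat.mul_le_mul_right M hlen))

end WeightedGraph

/-- Row `u` of the matrix of the values `window M T (dist u v)`, together with the centre `T`. -/
structure CentredRow (n : ℕ) where
  centre : ℕ
  row : Fin n → ℕ∞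

/-- The windows with centre `T` of the entries of a row. -/
noncomputable def windowRow {n : ℕ} (M T : ℕ) (d : Fin n → ℕ∞) : CentredRow n :=
  ⟨T, fun v => window M T (d v)⟩

/-- The rows of windows around the sum of the centres of `x` and `y`, by a min-plus product. Both
factors are shifted by `2 * M`, hence the subtraction. -/
noncomputable def combine {n : ℕ} (M : ℕ) (x y : Fin n → CentredRow n) (i : Fin n) :
    CentredRow n where
  centre := (x i).centre + (y i).centre
  row v := trunc (4 * M)
    (minPlus (4 * M) (fun u => (x u).row) (fun u => (y u).row) i v - (2 * M : ℕ))

/-- What a node stores during the binary search for the diameter: its row around the current lower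
bound for the diameter, and its rows around the powers of two times `M` that remain to be tried,
in decreasing order. -/
structure SearchState (n : ℕ) where
  current : CentredRow n
  stack : List (CentredRow n)

/-- The row on top of the stack. The default value is irrelevant: the stack of a node is never
empty when this is used. -/
def SearchState.top {n : ℕ} (s : SearchState n) : CentredRow n := s.stack.headD s.current

/-- The state of a node that knows its row of distances, before the stack is filled. -/
noncomputable def initialState {n : ℕ} (M : ℕ) (d : Fin n → ℕ∞) : SearchState n :=
  ⟨windowRow M 0 d, [windowRow M M d]⟩

/-- Push the row around twice the centre of the top one. -/
noncomputable def ladderStep {n : ℕ} (M : ℕ) (x : Fin n → SearchState n) (i : Fin n) :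
    SearchState n :=
  ⟨(x i).current, combine M (fun u => (x u).top) (fun u => (x u).top) i :: (x i).stack⟩

/-- The rows around the next candidate for a lower bound. -/
noncomputable def trial {n : ℕ} (M : ℕ) (x : Fin n → SearchState n) : Fin n → CentredRow n :=
  combine M (fun u => (x u).current) (fun u => (x u).top)

open Classical in
/-- Accept the candidate if some distance exceeds it, and pop the stack. -/
noncomputable def searchStep {n : ℕ} (M : ℕ) (x : Fin n → SearchState n) (i : Fin n) :
    SearchState n :=
  ⟨if ∃ j v, ((2 * M : ℕ) : ℕ∞) < (trial M x j).row v then trial M x i else (x i).current,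
    (x i).stack.tail⟩

/-- The value that is read off at the end of the search: the centre plus the largest offset. -/
noncomputable def readDiameter {n : ℕ} (M : ℕ) (x : Fin n → SearchState n) (i : Fin n) : ℕ∞ :=
  (⨆ j, trunc (4 * M) (⨆ v, (x j).current.row v)) + (x i).current.centre - (2 * M : ℕ)

namespace WeightedGraph

variable {n M : ℕ} (G : WeightedGraph n M)

theorem combine_windowRow_dist (S T : ℕ) :
    combine M (fun u => windowRow M S (G.dist u)) (fun u => windowRow M T (G.dist u)) =
      fun u => windowRow M (S + T) (G.dist u) := by
  funext u
  simp only [combine, windowRow, window_add]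

/-- The stack of node `i` with `m` entries. -/
noncomputable def ladder (m : ℕ) (i : Fin n) : List (CentredRow n) :=
  match m with
  | 0 => []
  | m + 1 => windowRow M (2 ^ m * M) (G.dist i) :: ladder m i

/-- The states in the search with lower bound `S` and with `m` candidates to be tried. -/
noncomputable def searchState (S m : ℕ) (i : Fin n) : SearchState n :=
  ⟨windowRow M S (G.dist i), G.ladder m i⟩

theorem initialState_iterate_squareStep {k : ℕ} (hk : n ≤ 2 ^ k) :
    (fun i => initialState M ((squareStep (4 * M))^[k] G.reflAdjMatrix i)) =
      G.searchState 0 1 := by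
  funext i
  simp only [initialState, searchState, ladder, windowRow, pow_zero, one_mul,
    G.window_iterate_squareStep hk (Nat.zero_le _),
    G.window_iterate_squareStep hk (Nat.le_mul_of_pos_left M two_pos)]

theorem ladderStep_searchState (S m : ℕ) :
    ladderStep M (G.searchState S (m + 1)) = G.searchState S (m + 2) := by
  funext i
  simp only [ladderStep, SearchState.top, searchState, ladder, List.headD_cons,
    combine_windowRow_dist, ← two_mul, pow_succ', mul_assoc]

theorem iterate_ladderStep_searchState (S k : ℕ) :
    (ladderStep M)^[k] (G.searchState S 1) = G.searchState S (k + 1) := by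
  induction k with
  | zero => rfl
  | succ k ih => rw [Function.iterate_succ_apply', ih, ladderStep_searchState]

theorem trial_searchState (S m : ℕ) :
    trial M (G.searchState S (m + 1)) = fun u => windowRow M (S + 2 ^ m * M) (G.dist u) := by
  simp only [trial, SearchState.top, searchState, ladder, List.headD_cons, combine_windowRow_dist]

theorem exists_lt_trial_iff (hn : 0 < n) (S m : ℕ) :
    (∃ j v, ((2 * M : ℕ) : ℕ∞) < (trial M (G.searchState S (m + 1)) j).row v) ↔
      ((S + 2 ^ m * M : ℕ) : ℕ∞) < G.diameter := by
  simp only [trial_searchState, windowRow, lt_window_iff]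
  refine ⟨fun ⟨j, v, h⟩ => h.trans_le (G.dist_le_diameter j v), fun h => ?_⟩
  obtain ⟨u, v, huv⟩ := G.exists_dist_eq_diameter hn
  exact ⟨u, v, huv ▸ h⟩

/-- The invariant of the search: the diameter is in the interval from the lower bound `S` to
`S + 2 ^ m * M`, where `m` is the height of the stacks. -/
def SearchInvariant (m : ℕ) (x : Fin n → SearchState n) : Prop :=
  ∃ S : ℕ, (S : ℕ∞) ≤ G.diameter ∧ (G.diameter ≠ ⊤ → G.diameter ≤ (S + 2 ^ m * M : ℕ)) ∧
    x = G.searchState S m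

variable {G} {m : ℕ} {x : Fin n → SearchState n}

theorem SearchInvariant.searchStep (hn : 0 < n) (h : G.SearchInvariant (m + 1) x) :
    G.SearchInvariant m (searchStep M x) := by
  obtain ⟨S, hS, hlt, rfl⟩ := h
  by_cases hD : ((S + 2 ^ m * M : ℕ) : ℕ∞) < G.diameter
  · refine ⟨S + 2 ^ m * M, hD.le, fun h => (hlt h).trans_eq ?_, funext fun i => ?_⟩
    · rw [pow_succ, mul_two, add_mul, add_assoc]
    · rw [CongestedClique.searchStep, if_pos ((G.exists_lt_trial_iff hn S m).2 hD),
        trial_searchState]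
      rfl
  · refine ⟨S, hS, fun _ => not_lt.1 hD, funext fun i => ?_⟩
    rw [CongestedClique.searchStep, if_neg (mt (G.exists_lt_trial_iff hn S m).1 hD)]
    rfl

theorem SearchInvariant.iterate_searchStep (hn : 0 < n) (h : G.SearchInvariant m x) :
    G.SearchInvariant 0 ((CongestedClique.searchStep M)^[m] x) := by
  induction m generalizing x with
  | zero => exact h
  | succ m ih => exact ih (h.searchStep hn)

theorem SearchInvariant.readDiameter_eq (hn : 0 < n) (h : G.SearchInvariant 0 x) (i : Fin n) :
    readDiameter M x i = G.diameter := by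
  obtain ⟨S, hS, hlt, rfl⟩ := h
  obtain ⟨u, v, huv⟩ := G.exists_dist_eq_diameter hn
  have largest_offset : ⨆ j, trunc (4 * M) (⨆ v, window M S (G.dist j v)) =
      window M S G.diameter := by
    refine le_antisymm (iSup_le fun j => ?_) ?_
    · refine (trunc_mono _ (iSup_le fun v => window_mono M S (G.dist_le_diameter j v))).trans_eq ?_
      exact trunc_trunc _ _
    · rw [← huv]
      exact (le_iSup (fun v => window M S (G.dist u v)) v).trans ((le_trunc _ _).trans
        (le_iSup (fun j => trunc (4 * M) (⨆ v, window M S (G.dist j v))) u))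
  simp only [readDiameter, searchState, windowRow, largest_offset]
  exact window_add_tsub hS (by simpa using hlt)

variable (G)

theorem readDiameter_search (hn : 0 < n) {k : ℕ} (hk : n ≤ 2 ^ k) (i : Fin n) :
    readDiameter M ((CongestedClique.searchStep M)^[k + 1] ((ladderStep M)^[k] fun i =>
      initialState M ((squareStep (4 * M))^[k] G.reflAdjMatrix i))) i = G.diameter := by
  refine SearchInvariant.readDiameter_eq hn (SearchInvariant.iterate_searchStep hn ?_) i
  rw [initialState_iterate_squareStep G hk, iterate_ladderStep_searchState]
  refine ⟨0, zero_le, fun h => (G.diameter_le h).trans (Nat.cast_le.2 ?_), rfl⟩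
  rw [zero_add]
  exact Nat.mul_le_mul_right M (hk.trans (Nat.pow_le_pow_right two_pos k.le_succ))

end WeightedGraph

section Computes

variable {n b R w M : ℕ}

theorem computes_combine {S : Type} (h : ComputesMinPlus n b R (4 * M)) (f g : S → CentredRow n) :
    Computes n b R fun (x : Fin n → S) i =>
      (x i, combine M (fun u => f (x u)) (fun u => g (x u)) i) :=
  h.dimap (fun s => ((f s).row, (g s).row)) fun s o => (s,
    { centre := (f s).centre + (g s).centre
      row := fun v => trunc (4 * M) (o v - (2 * M : ℕ)) : CentredRow n })

theorem computes_ladderStep (h : ComputesMinPlus n b R (4 * M)) :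
    Computes n b R (ladderStep (n := n) M) :=
  (computes_combine h SearchState.top SearchState.top).dimap id fun s o =>
    (⟨s.current, o.2 :: s.stack⟩ : SearchState n)

theorem computes_searchStep (hw : 2 ≤ 2 ^ (b * w)) (h : ComputesMinPlus n b R (4 * M)) :
    Computes n b (R + w) (searchStep (n := n) M) := by
  classical
  have announce := Computes.exchange (n := n) (b := b) (w := w) (V := Bool) (by simpa using hw)
    fun _ (s : SearchState n × CentredRow n) _ => decide (∃ v, ((2 * M : ℕ) : ℕ∞) < s.2.row v)
  have decide_step := announce.dimap id fun s o =>
    (⟨if ∃ j, o j = true then s.2 else s.1.current, s.1.stack.tail⟩ : SearchState n)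
  refine (decide_step.comp (computes_combine h SearchState.current SearchState.top)).congr
    fun x i => ?_
  simp only [id, decide_eq_true_eq]
  rfl

theorem computes_readDiameter (hw : 4 * M + 2 ≤ 2 ^ (b * w)) :
    Computes n b w (readDiameter (n := n) M) := by
  have announce := Computes.exchange (n := n) (b := b) (w := w) (V := Option (Fin (4 * M + 1)))
    (by rwa [Fintype.card_option, Fintype.card_fin])
    fun _ (s : SearchState n) _ => encodeTrunc (4 * M) (⨆ v, s.current.row v)
  refine (announce.dimap id fun s o =>
    (⨆ j, decodeTrunc (o j)) + s.current.centre - (2 * M : ℕ)).congr fun x i => ?_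
  simp only [id, decodeTrunc_encodeTrunc, readDiameter]

theorem exists_protocol_of_computesMinPlus {k : ℕ} (hn : 0 < n) (hk : n ≤ 2 ^ k)
    (hw : 4 * M + 2 ≤ 2 ^ (b * w))
    (h : ComputesMinPlus n b R (4 * M)) :
    ∃ P : Protocol n b (Fin n → ℕ∞) ℕ∞, ComputesDiameter M P ∧
      P.rounds = 2 * k * R + (k + 1) * (R + w) + w := by
  have diagonal := Computes.of_local (n := n) (b := b) fun i (s : Fin n → ℕ∞) v =>
    if v = i then 0 else s v
  have square : Computes n b R (squareStep (n := n) (4 * M)) :=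
    h.dimap (fun s => (s, s)) fun _ o => o
  have initial := (Computes.of_local (n := n) (b := b) fun _ => initialState (n := n) M).comp
    ((square.iterate k).comp diagonal)
  have ladder := ((computes_ladderStep h).iterate k).comp initial
  have search := ((computes_searchStep (w := w) (by omega) h).iterate (k + 1)).comp ladder
  obtain ⟨P, hrounds, hP⟩ := (computes_readDiameter hw).comp search
  exact ⟨P, fun G i => (hP _ i).trans (G.readDiameter_search hn hk i), by rw [hrounds]; ring⟩

end Computes

section Parameters

/-- With parts of size `e ≈ n / d` and `e ^ 2 / n` batches per node, every load in the batched
product is `O(e ^ 2)`. -/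
theorem exists_load_bounds {n d q : ℕ} (hn : 0 < n) (hd : 0 < d) (hdn : d * d ≤ n)
    (hq : q ≤ 9 * n) :
    ∃ e L r : ℕ, n ≤ d * e ∧ n ≤ L ∧ (e * e / n + 1) * (d * d) ≤ L ∧ (e * e / n + 1) * q ≤ L ∧
      (q / n + 1) * (e * e) ≤ L ∧ 2 * L ≤ n * r ∧ 1 ≤ r ∧ r * (d * d) ≤ 148 * n := by
  set e := n / d + 1 with he
  have hde : n ≤ d * e := (Nat.lt_mul_div_succ n hd).le
  have hde' : d * e ≤ 2 * n := by nlinarith [Nat.mul_div_le n d]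
  have hne : n ≤ e * e := by
    refine le_of_mul_le_mul_left (a := n) ?_ hn
    calc n * n ≤ (d * e) * (d * e) := Nat.mul_le_mul hde hde
      _ = (d * d) * (e * e) := mul_mul_mul_comm d e d e
      _ ≤ n * (e * e) := Nat.mul_le_mul_right _ hdn
  have hbatch : (e * e / n + 1) * n ≤ 2 * (e * e) := by
    rw [add_mul, one_mul]
    have := Nat.div_mul_le_self (e * e) n
    omega
  have hqn : q / n + 1 ≤ 10 := Nat.succ_le_succ (Nat.div_le_of_le_mul (by omega))
  have hr : n * (36 * (e * e) / n + 1) ≤ 37 * (e * e) := by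
    rw [mul_add, mul_one]
    have := Nat.mul_div_le (36 * (e * e)) n
    omega
  refine ⟨e, 18 * (e * e), 36 * (e * e) / n + 1, hde, by omega, ?_, ?_, ?_, ?_,
    Nat.succ_pos _, ?_⟩
  · exact (Nat.mul_le_mul_left _ hdn).trans (hbatch.trans (by omega))
  · calc (e * e / n + 1) * q ≤ (e * e / n + 1) * (9 * n) := Nat.mul_le_mul_left _ hq
      _ = 9 * ((e * e / n + 1) * n) := by ring
      _ ≤ 18 * (e * e) := by omega
  · exact (Nat.mul_le_mul_right _ hqn).trans (by omega)
  · rw [← mul_assoc]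
    exact (Nat.lt_mul_div_succ (36 * (e * e)) hn).le
  · refine le_of_mul_le_mul_left (a := n) ?_ hn
    calc n * ((36 * (e * e) / n + 1) * (d * d))
        ≤ 37 * (e * e) * (d * d) := by rw [← mul_assoc]; exact Nat.mul_le_mul_right _ hr
      _ = 37 * ((d * e) * (d * e)) := by ring
      _ ≤ 37 * ((2 * n) * (2 * n)) := Nat.mul_le_mul_left _ (Nat.mul_le_mul hde' hde')
      _ = n * (148 * n) := by ring

theorem exists_prime_mul_self_le_two_pow (D : ℕ) :
    ∃ w : ℕ, ∀ n : ℕ, 2 ≤ n →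
      ∃ p : ℕ, p.Prime ∧ 9 * n + D < p ∧ p * p ≤ 2 ^ (Nat.clog 2 n * w) := by
  refine ⟨(19 + 2 * D) * 2, fun n hn => ?_⟩
  obtain ⟨p, hp, hlt, hle⟩ := Nat.exists_prime_lt_and_le_two_mul (9 * n + D) (by omega)
  refine ⟨p, hp, hlt, ?_⟩
  have hclog : 1 ≤ Nat.clog 2 n := Nat.clog_pos one_lt_two hn
  rw [← mul_assoc, pow_mul, sq]
  refine Nat.mul_self_le_mul_self ?_
  calc p ≤ n * (18 + 2 * D) := by nlinarith
    _ ≤ 2 ^ Nat.clog 2 n * 2 ^ (18 + 2 * D) :=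
      Nat.mul_le_mul (Nat.le_pow_clog one_lt_two n) Nat.lt_two_pow_self.le
    _ = 2 ^ (Nat.clog 2 n + (18 + 2 * D)) := (pow_add _ _ _).symm
    _ ≤ 2 ^ (Nat.clog 2 n * (19 + 2 * D)) := Nat.pow_le_pow_right two_pos (by nlinarith)

theorem clog_two_le_four_mul_log {n : ℕ} (hn : 2 ≤ n) :
    (Nat.clog 2 n : ℝ) ≤ 4 * Real.log n := by
  have hpow : (2 : ℝ) ^ (Nat.clog 2 n - 1) ≤ n := by
    exact_mod_cast (Nat.pow_pred_clog_lt_self one_lt_two hn).le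
  have hlog := Real.log_le_log (by positivity) hpow
  rw [Real.log_pow, Nat.cast_sub (Nat.clog_pos one_lt_two hn), Nat.cast_one] at hlog
  have hlog_two : Real.log 2 ≤ Real.log n := Real.log_le_log two_pos (by exact_mod_cast hn)
  nlinarith [Real.log_two_gt_d9, Nat.cast_nonneg (α := ℝ) (Nat.clog 2 n)]

/-- The exponent `j` is chosen maximal with `(m ^ σ) ^ j * M ≤ n`. -/
theorem exists_pow_mul_le_and_le_rpow {m t : ℕ} {σ : ℝ} (hm : 2 ≤ m) (hσ : 0 < σ)
    (ht : (t : ℝ) ≤ (m : ℝ) ^ σ) {n M : ℕ} (hM : 1 ≤ M) (hMn : M ≤ n) :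
    ∃ j : ℕ, t ^ j * M ≤ n ∧
      (n : ℝ) ≤
        (m : ℝ) ^ 2 * ((m ^ j : ℕ) : ℝ) ^ 2 * ((M : ℝ) ^ (2 / σ) * (n : ℝ) ^ (1 - 2 / σ)) := by
  have hm1 : (1 : ℝ) < m := by exact_mod_cast hm
  have hm0 : (0 : ℝ) < m := zero_lt_one.trans hm1
  have hM0 : (0 : ℝ) < M := by exact_mod_cast hM
  have hn0 : (0 : ℝ) < n := hM0.trans_le (by exact_mod_cast hMn)
  obtain ⟨j, hj, hj'⟩ := exists_nat_pow_near ((one_le_div hM0).2 (Nat.cast_le.2 hMn))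
    (Real.one_lt_rpow hm1 hσ)
  refine ⟨j, ?_, ?_⟩
  · have hjt : (t : ℝ) ^ j ≤ n / M := (pow_le_pow_left₀ (Nat.cast_nonneg _) ht j).trans hj
    rw [le_div_iff₀ hM0] at hjt
    exact_mod_cast hjt
  have hquot : ((n : ℝ) / M) ^ (2 / σ) ≤ (m : ℝ) ^ 2 * ((m ^ j : ℕ) : ℝ) ^ 2 := by
    calc ((n : ℝ) / M) ^ (2 / σ) ≤ (((m : ℝ) ^ σ) ^ (j + 1)) ^ (2 / σ) :=
          Real.rpow_le_rpow (by positivity) hj'.le (by positivity)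
      _ = (m : ℝ) ^ ((2 * (j + 1) : ℕ) : ℝ) := by
        rw [← Real.rpow_natCast, ← Real.rpow_mul hm0.le, ← Real.rpow_mul hm0.le]
        congr 1
        push_cast
        field_simp
      _ = (m : ℝ) ^ 2 * ((m ^ j : ℕ) : ℝ) ^ 2 := by
        rw [Real.rpow_natCast]
        push_cast
        ring
  calc (n : ℝ) = ((n : ℝ) / M) ^ (2 / σ) * ((M : ℝ) ^ (2 / σ) * (n : ℝ) ^ (1 - 2 / σ)) := by
        rw [Real.div_rpow hn0.le hM0.le, ← mul_assoc,
          div_mul_cancel₀ _ (Real.rpow_pos_of_pos hM0 _).ne', ← Real.rpow_add hn0,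
          add_sub_cancel, Real.rpow_one]
    _ ≤ _ := mul_le_mul_of_nonneg_right hquot (by positivity)

end Parameters

theorem exists_computesMinPlus {n b w M p : ℕ} [Fact p.Prime] {ι τ : Type} [Fintype ι]
    [DecidableEq ι] [Nonempty ι] [Fintype τ] (s : Scheme (ZMod p) ι τ) (hM : 1 ≤ M)
    (hτ : Fintype.card τ * M ≤ n) (hp : 9 * n < p) (hpw : p * p ≤ 2 ^ (b * w)) :
    ∃ r : ℕ, 1 ≤ r ∧ r * Fintype.card ι ^ 2 ≤ 148 * n ∧
      ComputesMinPlus n b (8 * (w * r)) (4 * M) := by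
  have hι : 0 < Fintype.card ι := Fintype.card_pos
  have hιτ : Fintype.card ι * Fintype.card ι ≤ Fintype.card τ := by
    simpa only [sq] using s.card_sq_le
  have hτ0 : 0 < Fintype.card τ := (Nat.mul_pos hι hι).trans_le hιτ
  have hτn : Fintype.card τ ≤ n := (Nat.le_mul_of_pos_right _ hM).trans hτ
  have hMn : M ≤ n := (Nat.le_mul_of_pos_left M hτ0).trans hτ
  obtain ⟨e, L, r, hblk, hnL, hιL, hτL, hκL, hL, hr, hrn⟩ := exists_load_bounds
    (n := n) (q := (2 * (4 * M) + 1) * Fintype.card τ) (hτ0.trans_le hτn) hι (hιτ.trans hτn)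
    (by nlinarith)
  obtain ⟨blk⟩ : Nonempty (Fin n ↪ ι × Fin e) :=
    Function.Embedding.nonempty_of_card_le (by simpa using hblk)
  refine ⟨r, hr, by rwa [sq], computesMinPlus (L := L) (hτ0.trans_le hτn) s blk (by omega) ?_ ?_ ?_
    hnL ?_ ?_ ?_ hL⟩
  · intro m hm hmn h
    have := Nat.le_of_dvd hm ((ZMod.natCast_eq_zero_iff m p).1 h)
    omega
  · rw [ZMod.card]
    omega
  · rwa [Fintype.card_prod, ZMod.card]
  all_goals simpa only [Fintype.card_prod, Fintype.card_fin]

theorem exists_computesMinPlus_pow {ι τ : Type} [Fintype ι] [DecidableEq ι] [Nonempty ι]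
    [Fintype τ] (s : Scheme ℚ ι τ) :
    ∃ w : ℕ, ∀ n M j : ℕ, 2 ≤ n → 1 ≤ M → M ≤ n → Fintype.card τ ^ j * M ≤ n →
      ∃ r : ℕ, 1 ≤ r ∧ r * (Fintype.card ι ^ j) ^ 2 ≤ 148 * n ∧
        4 * M + 2 ≤ 2 ^ (Nat.clog 2 n * w) ∧
        ComputesMinPlus n (Nat.clog 2 n) (8 * (w * r)) (4 * M) := by
  obtain ⟨D, hD⟩ := s.exists_zmod
  obtain ⟨w, hw⟩ := exists_prime_mul_self_le_two_pow D
  refine ⟨w, fun n M j hn hM hMn hj => ?_⟩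
  obtain ⟨p, hp, hlt, hpw⟩ := hw n hn
  have := Fact.mk hp
  obtain ⟨s'⟩ := hD p hp (by omega)
  obtain ⟨r, hr, hrn, hR⟩ := exists_computesMinPlus (s'.pow (Fin j)) hM (by simpa using hj)
    (by omega) hpw
  exact ⟨r, hr, by simpa using hrn, by nlinarith, hR⟩

theorem exists_protocol_of_scheme {ι τ : Type} [Fintype ι] [DecidableEq ι] [Nonempty ι]
    [Fintype τ] (s : Scheme ℚ ι τ) :
    ∃ C : ℝ, 0 ≤ C ∧ ∀ n M j : ℕ, 2 ≤ n → 1 ≤ M → M ≤ n → Fintype.card τ ^ j * M ≤ n →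
      ∃ P : Protocol n (Nat.clog 2 n) (Fin n → ℕ∞) ℕ∞, ComputesDiameter M P ∧
        (P.rounds : ℝ) * ((Fintype.card ι ^ j : ℕ) : ℝ) ^ 2 ≤ C * n * Real.log n := by
  obtain ⟨w, hw⟩ := exists_computesMinPlus_pow s
  refine ⟨20720 * w, by positivity, fun n M j hn hM hMn hj => ?_⟩
  obtain ⟨r, hr, hrn, hMw, hR⟩ := hw n M j hn hM hMn hj
  obtain ⟨P, hP, hrounds⟩ := exists_protocol_of_computesMinPlus (by omega)
    (Nat.le_pow_clog one_lt_two n) hMw hR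
  refine ⟨P, hP, ?_⟩
  have hrounds_le : P.rounds ≤ 35 * (Nat.clog 2 n * w * r) := by
    have hw_le : w ≤ Nat.clog 2 n * w := Nat.le_mul_of_pos_left w (Nat.clog_pos one_lt_two hn)
    have hbw : Nat.clog 2 n * w ≤ Nat.clog 2 n * w * r := Nat.le_mul_of_pos_right _ hr
    have hwr : w * r ≤ Nat.clog 2 n * w * r := Nat.mul_le_mul_right r hw_le
    rw [hrounds]
    linarith
  calc (P.rounds : ℝ) * ((Fintype.card ι ^ j : ℕ) : ℝ) ^ 2
      ≤ 35 * (Nat.clog 2 n * w * r) * ((Fintype.card ι ^ j : ℕ) : ℝ) ^ 2 := by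
        gcongr
        exact_mod_cast hrounds_le
    _ = 35 * Nat.clog 2 n * w * (r * ((Fintype.card ι ^ j : ℕ) : ℝ) ^ 2) := by ring
    _ ≤ 35 * (4 * Real.log n) * w * (148 * n) := by
        gcongr 35 * ?_ * _ * ?_
        · exact clog_two_le_four_mul_log hn
        · exact_mod_cast hrn
    _ = 20720 * w * n * Real.log n := by ring

theorem exists_protocol_rounds_eq_zero (b M : ℕ) :
    ∃ P : Protocol 1 b (Fin 1 → ℕ∞) ℕ∞, ComputesDiameter M P ∧ P.rounds = 0 := by
  refine ⟨⟨0, fun _ _ _ _ _ => false, fun _ _ _ => 0⟩, fun G i => ?_, rfl⟩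
  obtain ⟨u, v, huv⟩ := G.exists_dist_eq_diameter one_pos
  rw [← huv, Subsingleton.elim u v, G.dist_self]
  rfl

end CongestedClique

theorem mainTheorem11 (K : Type*) [Field K] [CharZero K] :
    ∃ c : ℕ, ∀ ε : ℝ, 0 < ε → ∃ C : ℝ, ∀ n M : ℕ, 1 ≤ M → M ≤ n →
      ∃ P : CongestedClique.Protocol n (Nat.clog 2 n) (Fin n → ℕ∞) ℕ∞,
        CongestedClique.ComputesDiameter M P ∧
        (P.rounds : ℝ) ≤
          C * ((M : ℝ) ^ (2 / (CongestedClique.matMulExponent K + ε)) *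
            (n : ℝ) ^ (1 - 2 / (CongestedClique.matMulExponent K + ε))) * Real.log n ^ c := by
  refine ⟨1, fun ε hε => ?_⟩
  obtain ⟨m, t, hm, ht, ⟨s⟩⟩ :=
    CongestedClique.exists_scheme_baseField_le_rpow_matMulExponent K ℚ hε
  have hσ : 0 < CongestedClique.matMulExponent K + ε := by
    linarith [CongestedClique.two_le_matMulExponent K]
  generalize CongestedClique.matMulExponent K + ε = σ at *
  have hm0 : 0 < m := by omega
  have : Nonempty (Fin m) := Fin.pos_iff_nonempty.1 hm0
  obtain ⟨C, hC0, hC⟩ := CongestedClique.exists_protocol_of_scheme s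
  refine ⟨C * (m : ℝ) ^ 2, fun n M hM hMn => ?_⟩
  obtain rfl | hn : n = 1 ∨ 2 ≤ n := by omega
  · obtain ⟨P, hP, hrounds⟩ := CongestedClique.exists_protocol_rounds_eq_zero (Nat.clog 2 1) M
    exact ⟨P, hP, by simp [hrounds]⟩
  obtain ⟨j, htj, hmj⟩ := CongestedClique.exists_pow_mul_le_and_le_rpow hm hσ ht hM hMn
  obtain ⟨P, hP, hrounds⟩ := hC n M j hn hM hMn (by rwa [Fintype.card_fin])
  rw [Fintype.card_fin] at hrounds
  refine ⟨P, hP, le_of_mul_le_mul_right (hrounds.trans ?_) (by positivity)⟩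
  calc C * n * Real.log n ≤ C * ((m : ℝ) ^ 2 * ((m ^ j : ℕ) : ℝ) ^ 2 *
        ((M : ℝ) ^ (2 / σ) * (n : ℝ) ^ (1 - 2 / σ))) * Real.log n := by gcongr
    _ = _ := by ring
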